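/- Let $N\ge 1$ and $D,k\ge 0$ be integers (with $0^0=1$). For a permutation $\pi\in\mathcal S_N$ let $B(\pi)=\sum_{i=1}^N|\pi(i)\rangle\langle i|$, and for an $N\times N$ unitary $U$ let $U^{\otimes k,k}=U^{\otimes k}\otimes(U^*)^{\otimes k}$, where $U^*$ is the entrywise complex conjugate; $\|\cdot\|_\infty$ denotes the operator norm. A probability distribution $\nu$ on $\mathcal S_N$ is a classical $(N,D,\lambda,k)$ tensor product expander (TPE) if $|\operatorname{supp}\nu|\le D$, $\lambda<1$ and $$\Bigl\|\mathbb E_{\pi\sim\nu}\bigl[B(\pi)^{\otimes k}\bigr]-\mathbb E_{\pi\sim\mathcal S_N}\bigl[B(\pi)^{\otimes k}\bigr]\Bigr\|_\infty\le\lambda ,$$ the second expectation being over the uniform distribution on $\mathcal S_N$. A probability distribution $\nu$ on the unitary group $\mathcal U(N)$ is a quantum $(N,D,\lambda,k)$-TPE if $|\operatorname{supp}\nu|\le D$, $\lambda<1$ and $$\Bigl\|\mathbb E_{U\sim\nu}\bigl[U^{\otimes k,k}\bigr]-\mathbb E_{U\sim\mathcal U(N)}\bigl[U^{\otimes k,k}\bigr]\Bigr\|_\infty\le\lambda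 ,$$ the second expectation being over the Haar probability measure. Let $\omega=e^{2\pi i/N}$ and let $\mathcal F=\frac1{\sqrt N}\sum_{m,n=1}^N\omega^{mn}|m\rangle\langle n|$ be the $N$-dimensional Fourier transform. Let $\nu_C$ be a classical $(N,D,1-\epsilon_C,2k)$-TPE, and for $0<p<1$ put $\nu_Q=p\,\nu_C+(1-p)\,\delta_{\mathcal F}$, a distribution on $\mathcal U(N)$, where $\pi$ is identified with $B(\pi)$ and $\delta_{\mathcal F}$ is the point mass at $\mathcal F$. Suppose that $$\epsilon_A:=1-\frac{2(2k)^{4k}}{\sqrt N}>0 .$$ Then for every $0<p<1$, $\nu_Q$ is a quantum $(N,D+1,1-\epsilon_Q,k)$-TPE for some $$\epsilon_Q\ \ge\ \frac{\epsilon_A}{12}\min(p\,\epsilon_C,\,1-p)\ >\ 0 ,$$ and if $|\operatorname{supp}\nu_C|=D$ then $|\operatorname{supp}\nu_Q|=D+1$. Over $0<p<1$ this lower bound is maximal at $p=1/(1+\epsilon_C)\in(0,1)$, and for this $p$ the distribution $\nu_Q$ is a quantum $(N,D+1,1-\epsilon_Q,k)$-TPE for some $\epsilon_Q\ge\epsilon_A\epsilon_C/24$.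 -/

import Mathlib

open MeasureTheory
open scoped Kronecker

noncomputable section

namespace TPE

/-- The group `𝒰(N)` of `N × N` complex unitary matrices. -/
abbrev U (N : ℕ) : Type := Matrix.unitaryGroup (Fin N) ℂ

/-- The Borel `σ`-algebra on `𝒰(N)`. -/
instance instMeasurableSpaceU (N : ℕ) : MeasurableSpace (U N) := borel _

instance instBorelSpaceU (N : ℕ) : BorelSpace (U N) := ⟨rfl⟩

instance instCompactSpaceU (N : ℕ) : CompactSpace (U N) := by
  apply isCompact_iff_compactSpace.mp
  have hK : IsCompact (Set.pi Set.univ fun _ : Fin N =>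
      Set.pi Set.univ fun _ : Fin N => Metric.closedBall (0 : ℂ) 1) :=
    isCompact_univ_pi fun _ => isCompact_univ_pi fun _ => isCompact_closedBall _ _
  refine IsCompact.of_isClosed_subset hK ?_ ?_
  · have : ((Matrix.unitaryGroup (Fin N) ℂ : Set (Matrix (Fin N) (Fin N) ℂ))) =
        {A | A * star A = 1} := by
      ext A
      exact Matrix.mem_unitaryGroup_iff
    rw [this]
    exact isClosed_eq (by fun_prop) continuous_const
  · intro A hA i _ j _
    simpa using entry_norm_bound_of_unitary hA i j

/-- The Haar probability measure on the compact group `𝒰(N)`. -/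
def haar (N : ℕ) : Measure (U N) := Measure.haarMeasure ⊤

/-- The `k`-fold tensor power `A^{⊗k}`, in the product basis `|i₁, …, i_k⟩`. -/
def tensorPow {N : ℕ} (k : ℕ) (A : Matrix (Fin N) (Fin N) ℂ) :
    Matrix (Fin k → Fin N) (Fin k → Fin N) ℂ :=
  Matrix.of fun i j => ∏ a, A (i a) (j a)

/-- `A^{⊗k,k} = A^{⊗k} ⊗ (A^*)^{⊗k}`, where `A^*` is the entrywise complex conjugate. -/
def tensorPow₂ {N : ℕ} (k : ℕ) (A : Matrix (Fin N) (Fin N) ℂ) :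
    Matrix ((Fin k → Fin N) × (Fin k → Fin N)) ((Fin k → Fin N) × (Fin k → Fin N)) ℂ :=
  tensorPow k A ⊗ₖ tensorPow k (A.map star)

/-- The Schatten `∞`-norm, i.e. the operator norm on `ℂⁿ` with its Euclidean norm. -/
def schattenInf {n : Type*} [Fintype n] [DecidableEq n] (A : Matrix n n ℂ) : ℝ :=
  ‖Matrix.toEuclideanCLM (𝕜 := ℂ) A‖

/-- The permutation matrix `B(π) = ∑ᵢ |π(i)⟩⟨i|`. -/
def B {N : ℕ} (π : Equiv.Perm (Fin N)) : Matrix (Fin N) (Fin N) ℂ :=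
  Matrix.of fun a b => if a = π b then 1 else 0

theorem B_mem {N : ℕ} (π : Equiv.Perm (Fin N)) : B π ∈ Matrix.unitaryGroup (Fin N) ℂ := by
  rw [Matrix.mem_unitaryGroup_iff']
  ext a b
  simp [B, Matrix.mul_apply, Matrix.star_apply, Matrix.one_apply, apply_ite, π.injective.eq_iff,
    eq_comm]

/-- The permutation matrix `B(π)` as an element of `𝒰(N)`. -/
def permU {N : ℕ} (π : Equiv.Perm (Fin N)) : U N := ⟨B π, B_mem π⟩

/-- `𝔼_{π ∼ ν} [B(π)^{⊗k}]`. -/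
def classicalMoment {N : ℕ} (k : ℕ) (ν : PMF (Equiv.Perm (Fin N))) :
    Matrix (Fin k → Fin N) (Fin k → Fin N) ℂ :=
  ∑ π, (ν π).toReal • tensorPow k (B π)

/-- `𝔼_{U ∼ μ} [U^{⊗k,k}]`, the integral being taken entry by entry. -/
def quantumMoment {N : ℕ} (k : ℕ) (μ : Measure (U N)) :
    Matrix ((Fin k → Fin N) × (Fin k → Fin N)) ((Fin k → Fin N) × (Fin k → Fin N)) ℂ :=
  Matrix.of fun i j => ∫ V : U N, tensorPow₂ k (V : Matrix (Fin N) (Fin N) ℂ) i j ∂μ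

/-- `ν` is a classical `(N, D, lam, k)` tensor product expander. -/
structure IsClassicalTPE (N D : ℕ) (lam : ℝ) (k : ℕ) (ν : PMF (Equiv.Perm (Fin N))) : Prop where
  support_le : ν.support.encard ≤ D
  norm_le : schattenInf (classicalMoment k ν -
    classicalMoment k (PMF.uniformOfFintype (Equiv.Perm (Fin N)))) ≤ lam
  lam_lt_one : lam < 1

/-- `ν` is a quantum `(N, D, lam, k)` tensor product expander. -/
structure IsQuantumTPE (N D : ℕ) (lam : ℝ) (k : ℕ) (ν : PMF (U N)) : Prop where
  support_le : ν.support.encard ≤ D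
  norm_le : schattenInf (quantumMoment k ν.toMeasure - quantumMoment k (haar N)) ≤ lam
  lam_lt_one : lam < 1

/-- The `N`-dimensional Fourier transform `N^{-1/2} ∑_{m,n=1}^N ω^{mn} |m⟩⟨n|`, `ω = e^{2πi/N}`.
The basis state `|m⟩`, `1 ≤ m ≤ N`, has index `m - 1` in `Fin N`. -/
def fourier (N : ℕ) : Matrix (Fin N) (Fin N) ℂ :=
  Matrix.of fun m n =>
    (1 / (Real.sqrt N : ℂ)) *
      Complex.exp (2 * Real.pi * Complex.I / N) ^ (((m : ℕ) + 1) * ((n : ℕ) + 1))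

theorem fourier_mem (N : ℕ) : fourier N ∈ Matrix.unitaryGroup (Fin N) ℂ := by
  rw [Matrix.mem_unitaryGroup_iff]
  ext a b
  have hN : N ≠ 0 := fun h => by subst h; exact a.elim0
  have hN' : (N : ℂ) ≠ 0 := Nat.cast_ne_zero.mpr hN
  set w : ℂ := Complex.exp (2 * Real.pi * Complex.I / N) with hw
  have hprim : IsPrimitiveRoot w N := Complex.isPrimitiveRoot_exp N hN
  have hw0 : w ≠ 0 := Complex.exp_ne_zero _
  have hconj : star w = w⁻¹ := by
    rw [hw, ← Complex.exp_neg, Complex.star_def, ← Complex.exp_conj]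
    congr 1
    simp [neg_div, map_ofNat]
  have hs : (1 / (Real.sqrt N : ℂ)) * star (1 / (Real.sqrt N : ℂ)) = (N : ℂ)⁻¹ := by
    have h : ((Real.sqrt N : ℝ) : ℂ) * ((Real.sqrt N : ℝ) : ℂ) = N := by
      rw [← Complex.ofReal_mul, Real.mul_self_sqrt (Nat.cast_nonneg N)]; simp
    simp only [one_div, Complex.star_def, map_inv₀, Complex.conj_ofReal]
    rw [← mul_inv, h]
  set z : ℂ := w ^ ((a : ℕ) + 1) * (w⁻¹) ^ ((b : ℕ) + 1) with hz
  have hterm : ∀ n : Fin N, fourier N a n * star (fourier N) n b =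
      (N : ℂ)⁻¹ * (z * z ^ (n : ℕ)) := by
    intro n
    simp only [Matrix.star_apply, fourier, Matrix.of_apply, star_mul', star_pow]
    rw [← hw, hconj, mul_mul_mul_comm, hs, ← pow_succ', hz, mul_pow, ← pow_mul, ← pow_mul]
  rw [Matrix.mul_apply, Finset.sum_congr rfl fun n _ => hterm n, ← Finset.mul_sum,
    ← Finset.mul_sum, Fin.sum_univ_eq_sum_range (fun i => z ^ i) N, Matrix.one_apply]
  split_ifs with hab
  · have hz1 : z = 1 := by
      rw [hz, hab, ← mul_pow, mul_inv_cancel₀ hw0, one_pow]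
    simp [hz1, hN']
  · have hz1 : z ≠ 1 := by
      intro h
      apply hab
      rw [hz, inv_pow, ← div_eq_mul_inv, div_eq_one_iff_eq (pow_ne_zero _ hw0), pow_succ, pow_succ]
        at h
      exact Fin.ext (hprim.pow_inj a.2 b.2 (mul_right_cancel₀ hw0 h))
    have hzN : z ^ N = 1 := by
      rw [hz, mul_pow, ← pow_mul, ← pow_mul, mul_comm _ N, mul_comm _ N, pow_mul, pow_mul,
        inv_pow, hprim.pow_eq_one]
      simp
    have hg : ∑ i ∈ Finset.range N, z ^ i = 0 := by
      have h := geom_sum_mul z N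
      rw [hzN, sub_self] at h
      exact (mul_eq_zero.mp h).resolve_right (sub_ne_zero.mpr hz1)
    simp [hg]

/-- The Fourier transform as an element of `𝒰(N)`. -/
def fourierU (N : ℕ) : U N := ⟨fourier N, fourier_mem N⟩

/-- The mixture `p μ + (1 - p) ν` of two discrete probability distributions. -/
def mix {α : Type*} (p : ℝ) (hp : p ∈ Set.Icc (0 : ℝ) 1) (μ ν : PMF α) : PMF α :=
  ⟨fun a => ENNReal.ofReal p * μ a + ENNReal.ofReal (1 - p) * ν a, by
    have h : ∑' a, (ENNReal.ofReal p * μ a + ENNReal.ofReal (1 - p) * ν a) = 1 := by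
      rw [ENNReal.tsum_add, ENNReal.tsum_mul_left, ENNReal.tsum_mul_left, μ.tsum_coe, ν.tsum_coe,
        mul_one, mul_one, ← ENNReal.ofReal_add hp.1 (sub_nonneg.mpr hp.2)]
      simp
    exact h ▸ ENNReal.summable.hasSum⟩

/-- `ν_Q = p ν_C + (1 - p) δ_F`, where a distribution `ν_C` on permutations is regarded as the
distribution of `B(π)`, `π ∼ ν_C`, on `𝒰(N)`. -/
def nuQ {N : ℕ} (p : ℝ) (hp : p ∈ Set.Icc (0 : ℝ) 1) (νC : PMF (Equiv.Perm (Fin N))) : PMF (U N) :=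
  mix p hp (νC.map permU) (PMF.pure (fourierU N))

/-- `ε_A = 1 - 2 (2k)^{4k} / √N`. -/
def epsA (N k : ℕ) : ℝ := 1 - 2 * (2 * (k : ℝ)) ^ (4 * k) / Real.sqrt N

/-- The bound `(ε_A / 12) min(p ε_C, 1 - p)`. -/
def gapBound (N k : ℕ) (εC p : ℝ) : ℝ := epsA N k / 12 * min (p * εC) (1 - p)

end TPE

end

/-! Write `X` for the `ν_C`-average of `B(π)^{⊗k,k}`, `P` for its uniform average, `Y` for
`F^{⊗k,k}` and `G` for the Haar average. Permutation matrices are real, so `B^{⊗k,k}` is `B^{⊗2k}`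
and the classical hypothesis of order `2k` says `‖X - P‖ ≤ 1 - ε_C`. Here `P` and `G` are orthogonal
projections, and `X` and `Y` fix the range of `G`, so only vectors `w` with `G w = 0` matter.

Split `w = a + b` with `a = P w`. If `b` carries much of the mass, `X` contracts `w`. If `a` does,
`X` fixes `a` but `Y` moves it far, so `X w` and `Y w` are far apart and strict convexity makes
their mixture short. `norm_mixture_sub_le` turns this into a gap, provided `Re ⟨a, Y a⟩ ≤ (1 - ε_A)
‖a‖²` whenever `P a = a` and `G a = 0`.

That estimate is `norm_fourier_form_le`. A vector fixed by `P` is constant on tuples with the same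
coincidence pattern, a partition of the `2k` tensor factors. By `exists_block_or_small_or_pairing` a
partition has a block among unconjugated factors only, or among conjugated ones only, or fewer than
`k` blocks, or is the pairing of a permutation `σ`. A one-sided block gives a nontrivial character,
and its Fourier cancellation makes overlaps of order `1/√N`; two patterns with few blocks contain
too few tuples to overlap more (`norm_overlap_le`). Pairings are the genuine obstruction, but `G a =
0` makes `a` orthogonal to the unitarily invariant vector of every `σ`, which leaves mass only
`O(k²/N)` on each pairing class (`sum_pairing_norm_sq_le`). At most `(2k)^{2k}` partitions occur,
whence `ε_A`. -/

noncomputable section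

namespace TPE

/-! ### Gap of a convex combination of two contractions. -/

section Mixing

variable {H : Type*} [NormedAddCommGroup H] [InnerProductSpace ℂ H]

/-- The strict convexity of the square of the norm, quantitatively. -/
theorem norm_sq_convexCombination (p : ℝ) (x y : H) :
    ‖(p : ℂ) • x + ((1 - p : ℝ) : ℂ) • y‖ ^ 2 =
      p * ‖x‖ ^ 2 + (1 - p) * ‖y‖ ^ 2 - p * (1 - p) * ‖x - y‖ ^ 2 := by
  rw [norm_add_sq (𝕜 := ℂ), norm_sub_sq (𝕜 := ℂ), inner_smul_left, inner_smul_right, norm_smul,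
    norm_smul, Complex.conj_ofReal, ← mul_assoc, ← Complex.ofReal_mul]
  simp only [RCLike.re_to_complex, Complex.re_ofReal_mul, Complex.norm_real, mul_pow,
    Real.norm_eq_abs, sq_abs]
  ring

/-- One of `p`, `1 - p` is at least `1/2`, and the other is at least the minimum because `ε ≤ 1`. -/
theorem mul_one_sub_ge_half_min {p ε : ℝ} (hp : p ∈ Set.Ioo (0 : ℝ) 1) (hε : ε ≤ 1) :
    min (p * ε) (1 - p) / 2 ≤ p * (1 - p) := by
  obtain ⟨h0, h1⟩ := hp
  rcases le_total p (1 / 2) with h | h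
  · have := min_le_left (p * ε) (1 - p)
    nlinarith
  · have := min_le_right (p * ε) (1 - p)
    nlinarith

/-- The numerical inequality behind `norm_convexCombination_le`. -/
theorem convexCombination_sq_le {p εC εA α β β' d y : ℝ} (hp : p ∈ Set.Ioo (0 : ℝ) 1)
    (hC0 : 0 < εC) (hC1 : εC ≤ 1) (hA1 : εA ≤ 1) (hβ0 : 0 ≤ β')
    (hβ' : β' ≤ (1 - εC) * β) (hy : y ^ 2 ≤ α ^ 2 + β ^ 2)
    (hd : 2 * εA * α ^ 2 ≤ (d + 2 * β) ^ 2) :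
    p * (α ^ 2 + β' ^ 2) + (1 - p) * y ^ 2 - p * (1 - p) * d ^ 2 ≤
      (1 - εA / 6 * min (p * εC) (1 - p)) * (α ^ 2 + β ^ 2) := by
  have hmhalf := mul_one_sub_ge_half_min hp hC1
  obtain ⟨h0, h1⟩ := hp
  have hm0 : 0 < min (p * εC) (1 - p) := lt_min (mul_pos h0 hC0) (by linarith)
  have hmC : min (p * εC) (1 - p) ≤ p * εC := min_le_left _ _
  generalize min (p * εC) (1 - p) = m at *
  have hb2 : β' ^ 2 ≤ (1 - εC) * β ^ 2 := by
    have : β' ^ 2 ≤ ((1 - εC) * β) ^ 2 := by gcongr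
    nlinarith [mul_nonneg (mul_nonneg hC0.le (sub_nonneg.2 hC1)) (sq_nonneg β)]
  -- Cauchy–Schwarz for `(1, √2)` and `(d, √2 β)`.
  have hCS : 2 * εA * α ^ 2 ≤ 3 * (d ^ 2 + 2 * β ^ 2) := by
    nlinarith [sq_nonneg (d - β)]
  -- `α² + β²` is at most twice the larger square: if that is `α²`, use `hCS`; if it is `β²`, the
  -- term `β²` alone suffices as `εA ≤ 1`.
  have hgain : εA / 6 * (α ^ 2 + β ^ 2) ≤ β ^ 2 + d ^ 2 / 2 := by
    rcases le_total (β ^ 2) (α ^ 2) with h | h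
    · nlinarith
    · nlinarith [sq_nonneg d, sq_nonneg β, sq_nonneg α]
  have e1 : p * β' ^ 2 ≤ p * ((1 - εC) * β ^ 2) := by gcongr
  have e2 : (1 - p) * y ^ 2 ≤ (1 - p) * (α ^ 2 + β ^ 2) :=
    mul_le_mul_of_nonneg_left hy (by linarith)
  have e3 : m / 2 * d ^ 2 ≤ p * (1 - p) * d ^ 2 := by gcongr
  have e4 : m * β ^ 2 ≤ p * εC * β ^ 2 := by gcongr
  have e5 := mul_le_mul_of_nonneg_left hgain hm0.le
  linarith

/-- A vector on which `X` and `Y` act is contracted by `p X + (1 - p) Y`, if it is the sum of a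
vector `a` fixed by `X` but moved by `Y`, and a vector `b` orthogonal to `a` contracted by `X`. -/
theorem norm_convexCombination_le {p εC εA : ℝ} (hp : p ∈ Set.Ioo (0 : ℝ) 1) (hC0 : 0 < εC)
    (hC1 : εC ≤ 1) (hA0 : 0 < εA) (hA1 : εA ≤ 1) {a b b' Ya Yb : H}
    (hab : inner ℂ a b = 0) (hab' : inner ℂ a b' = 0) (hb' : ‖b'‖ ≤ (1 - εC) * ‖b‖)
    (hYa : ‖Ya‖ = ‖a‖) (hYb : ‖Yb‖ ≤ ‖b‖) (hY : ‖Ya + Yb‖ ≤ ‖a + b‖)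
    (hre : (inner ℂ a Ya).re ≤ (1 - εA) * ‖a‖ ^ 2) :
    ‖(p : ℂ) • (a + b') + ((1 - p : ℝ) : ℂ) • (Ya + Yb)‖ ≤
      (1 - εA / 12 * min (p * εC) (1 - p)) * ‖a + b‖ := by
  have hs : ‖a + b‖ ^ 2 = ‖a‖ ^ 2 + ‖b‖ ^ 2 := by
    rw [norm_add_sq (𝕜 := ℂ), hab]; simp
  have hs' : ‖a + b'‖ ^ 2 = ‖a‖ ^ 2 + ‖b'‖ ^ 2 := by
    rw [norm_add_sq (𝕜 := ℂ), hab']; simp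
  have hbb : ‖b'‖ ≤ ‖b‖ := by nlinarith [norm_nonneg b]
  have hlow : 2 * εA * ‖a‖ ^ 2 ≤ ‖a - Ya‖ ^ 2 := by
    rw [norm_sub_sq (𝕜 := ℂ), hYa, RCLike.re_to_complex]; linarith
  have htri : ‖a - Ya‖ ≤ ‖(a + b') - (Ya + Yb)‖ + 2 * ‖b‖ := by
    have : a - Ya = ((a + b') - (Ya + Yb)) + (Yb - b') := by abel
    rw [this]
    calc _ ≤ ‖(a + b') - (Ya + Yb)‖ + ‖Yb - b'‖ := norm_add_le _ _
      _ ≤ ‖(a + b') - (Ya + Yb)‖ + (‖Yb‖ + ‖b'‖) := by gcongr; exact norm_sub_le _ _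
      _ ≤ _ := by linarith
  have hsq := convexCombination_sq_le hp hC0 hC1 hA1 (norm_nonneg b') hb'
    (y := ‖Ya + Yb‖) (by rw [← hs]; gcongr) (hlow.trans (by gcongr))
  rw [← hs', ← norm_sq_convexCombination, ← hs] at hsq
  have hm1 : min (p * εC) (1 - p) ≤ 1 :=
    (min_le_right _ _).trans (by linarith [hp.1])
  have hm0 : 0 ≤ min (p * εC) (1 - p) := le_min (mul_pos hp.1 hC0).le (by linarith [hp.2])
  generalize min (p * εC) (1 - p) = m at *
  have hm2 : εA / 12 * m ≤ 1 := by nlinarith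
  refine le_of_sq_le_sq ?_ (mul_nonneg (by linarith) (norm_nonneg _))
  rw [mul_pow]
  refine hsq.trans ?_
  gcongr
  -- `1 - 2x ≤ (1 - x)²` with `x = εA m / 12`: taking the square root turns `6` into `12`.
  nlinarith [sq_nonneg (εA / 12 * m)]

variable [CompleteSpace H]

/-- `X` has a gap `εC` above its fixed space, the range of the projection `P`, and `Y` moves the
vectors in the range of `P` that are orthogonal to the common fixed space, the range of `G`. -/
theorem norm_mixture_sub_le {p εC εA : ℝ} (hp : p ∈ Set.Ioo (0 : ℝ) 1) (hC0 : 0 < εC)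
    (hC1 : εC ≤ 1) (hA0 : 0 < εA) (hA1 : εA ≤ 1) {X Y P G : H →L[ℂ] H}
    (hG : IsSelfAdjoint G) (hGG : G * G = G) (hP : IsSelfAdjoint P) (hPP : P * P = P)
    (hXP : X * P = P) (hPX : P * X = P) (hX : ‖X - P‖ ≤ 1 - εC) (hY : ∀ v, ‖Y v‖ = ‖v‖)
    (hXG : X * G = G) (hYG : Y * G = G) (hGP : G * P = G)
    (hgap : ∀ v, G v = 0 → P v = v → (inner ℂ v (Y v)).re ≤ (1 - εA) * ‖v‖ ^ 2) :
    ‖(p : ℂ) • X + ((1 - p : ℝ) : ℂ) • Y - G‖ ≤ 1 - εA / 12 * min (p * εC) (1 - p) := by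
  have sym : ∀ {T : H →L[ℂ] H}, IsSelfAdjoint T → ∀ x y, inner ℂ (T x) y = inner ℂ x (T y) :=
    fun hT x y => (ContinuousLinearMap.isSelfAdjoint_iff_isSymmetric.1 hT) x y
  have app : ∀ {S T R : H →L[ℂ] H}, S * T = R → ∀ v, S (T v) = R v := by
    rintro S T R rfl v; rfl
  have hpos : 0 ≤ 1 - εA / 12 * min (p * εC) (1 - p) := by
    have := min_le_right (p * εC) (1 - p)
    have h0 : 0 ≤ min (p * εC) (1 - p) := le_min (mul_pos hp.1 hC0).le (by linarith [hp.2])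
    nlinarith [hp.1]
  refine ContinuousLinearMap.opNorm_le_bound _ hpos fun v => ?_
  -- `X` and `Y` fix `G v`, so subtracting `G` leaves exactly the mixture applied to `w`, which lies
  -- in the kernel of `G`.
  set w := v - G v with hw
  have hGw : G w = 0 := by rw [hw, map_sub, app hGG, sub_self]
  have hwv : ‖w‖ ≤ ‖v‖ := by
    have h : inner ℂ w (G v) = 0 := by rw [← sym hG, hGw, inner_zero_left]
    have : ‖v‖ ^ 2 = ‖w‖ ^ 2 + ‖G v‖ ^ 2 := by
      conv_lhs => rw [show v = w + G v by rw [hw]; abel]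
      rw [norm_add_sq (𝕜 := ℂ), h]; simp
    exact le_of_sq_le_sq (by nlinarith [sq_nonneg ‖G v‖]) (norm_nonneg _)
  have hv : ((p : ℂ) • X + ((1 - p : ℝ) : ℂ) • Y - G) v =
      (p : ℂ) • X w + ((1 - p : ℝ) : ℂ) • Y w := by
    have h1 : X w = X v - G v := by rw [hw, map_sub, app hXG]
    have h2 : Y w = Y v - G v := by rw [hw, map_sub, app hYG]
    rw [h1, h2, smul_sub, smul_sub]
    simp only [sub_apply, add_apply,
      smul_apply]
    have : G v = (p : ℂ) • G v + ((1 - p : ℝ) : ℂ) • G v := by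
      rw [← add_smul]; simp
    nth_rw 1 [this]; abel
  clear_value w
  have hPb : P (w - P w) = 0 := by rw [map_sub, app hPP, sub_self]
  have hXw : X w = P w + X (w - P w) := by rw [map_sub, app hXP]; abel
  have hYw : Y w = Y (P w) + Y (w - P w) := by rw [map_sub]; abel
  have hww : P w + (w - P w) = w := by abel
  have key := norm_convexCombination_le (a := P w) (b := w - P w) (b' := X (w - P w))
    (Ya := Y (P w)) (Yb := Y (w - P w)) hp hC0 hC1 hA0 hA1
    (by rw [sym hP, hPb, inner_zero_right])
    (by rw [sym hP, app hPX, hPb, inner_zero_right])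
    (by
      have : X (w - P w) = (X - P) (w - P w) := by
        rw [sub_apply, hPb, sub_zero]
      rw [this]
      exact (ContinuousLinearMap.le_opNorm _ _).trans (by gcongr))
    (hY _) (hY _).le (by rw [← map_add]; exact (hY _).le)
    (hgap _ (by rw [app hGP, hGw]) (app hPP _))
  rw [← hXw, ← hYw, hww] at key
  rw [hv]
  exact key.trans (by gcongr)

end Mixing

/-! ### Tensor products of matrices over an arbitrary finite set of factors. -/

section Tensor

variable {ι n : Type*} [Fintype ι]

/-- The tensor product `⨂ₓ K x` of a family of matrices, in the product basis. -/
def tensor (K : ι → Matrix n n ℂ) : Matrix (ι → n) (ι → n) ℂ :=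
  Matrix.of fun i j => ∏ x, K x (i x) (j x)

theorem tensor_apply (K : ι → Matrix n n ℂ) (i j : ι → n) :
    tensor K i j = ∏ x, K x (i x) (j x) := rfl

theorem tensor_mul [DecidableEq ι] [Fintype n] (K L : ι → Matrix n n ℂ) :
    tensor K * tensor L = tensor fun x => K x * L x := by
  ext i j
  simp_rw [Matrix.mul_apply, tensor_apply, Matrix.mul_apply, Fintype.prod_sum,
    Finset.prod_mul_distrib]

theorem tensor_one [DecidableEq ι] [DecidableEq n] :
    tensor (fun _ : ι => (1 : Matrix n n ℂ)) = 1 := by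
  ext i j
  simp only [tensor_apply, Matrix.one_apply]
  rw [Finset.prod_ite_zero]
  simp [funext_iff]

theorem tensor_conjTranspose (K : ι → Matrix n n ℂ) :
    (tensor K).conjTranspose = tensor fun x => (K x).conjTranspose := by
  ext i j
  simp [tensor_apply, Matrix.conjTranspose_apply]

end Tensor

/-! ### The powers `A^{⊗k,k}` and `A^{⊗2k}` on a common index set. -/

variable {N : ℕ}

/-- `A^{⊗k,k}`, with the tensor factors indexed by `Fin k ⊕ Fin k`. -/
def tensorSum (k : ℕ) (A : Matrix (Fin N) (Fin N) ℂ) :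
    Matrix (Fin k ⊕ Fin k → Fin N) (Fin k ⊕ Fin k → Fin N) ℂ :=
  tensor (Sum.elim (fun _ => A) (fun _ => A.map star))

theorem tensorSum_mul (k : ℕ) (A B : Matrix (Fin N) (Fin N) ℂ) :
    tensorSum k (A * B) = tensorSum k A * tensorSum k B := by
  rw [tensorSum, tensorSum, tensorSum, tensor_mul]
  congr 1
  funext x
  rcases x with x | x
  · rfl
  · exact Matrix.map_mul (f := starRingEnd ℂ)

theorem tensorSum_one (k : ℕ) : tensorSum k (1 : Matrix (Fin N) (Fin N) ℂ) = 1 := by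
  rw [tensorSum, ← tensor_one]
  congr 1
  funext x
  rcases x with x | x
  · rfl
  · exact Matrix.map_one _ (star_zero ℂ) (star_one ℂ)

theorem tensorSum_star (k : ℕ) (A : Matrix (Fin N) (Fin N) ℂ) :
    tensorSum k (star A) = star (tensorSum k A) := by
  rw [Matrix.star_eq_conjTranspose, Matrix.star_eq_conjTranspose, tensorSum, tensorSum,
    tensor_conjTranspose]
  congr 1
  funext x
  rcases x with x | x <;> rfl

theorem tensorSum_apply_elim (k : ℕ) (A : Matrix (Fin N) (Fin N) ℂ) (i j : Fin k ⊕ Fin k → Fin N) :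
    tensorSum k A i j = (∏ x, A (i (.inl x)) (j (.inl x))) *
      ∏ x, star (A (i (.inr x)) (j (.inr x))) := by
  simp [tensorSum, tensor_apply, Fintype.prod_sum_type]

theorem tensorPow₂_eq_submatrix (k : ℕ) (A : Matrix (Fin N) (Fin N) ℂ) :
    tensorPow₂ k A = (tensorSum k A).submatrix (Equiv.sumArrowEquivProdArrow _ _ _).symm
      (Equiv.sumArrowEquivProdArrow _ _ _).symm := by
  ext i j
  simp only [tensorPow₂, tensorPow, Matrix.kroneckerMap_apply, Matrix.submatrix_apply,
    tensorSum_apply_elim]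
  rfl

/-- This is why the classical expander is needed at order `2k`: conjugation does nothing to the last
`k` factors. -/
theorem B_map_star (π : Equiv.Perm (Fin N)) : (B π).map star = B π := by
  ext a b
  simp [B, apply_ite]

/-- A tuple indexed by `Fin (2 * k)` as one indexed by `Fin k ⊕ Fin k`. -/
def tupleEquiv (N k : ℕ) : (Fin (2 * k) → Fin N) ≃ (Fin k ⊕ Fin k → Fin N) :=
  Equiv.arrowCongr (finSumFinEquiv.trans (finCongr (two_mul k).symm)).symm (Equiv.refl _)

theorem tensorPow_B_eq_submatrix (k : ℕ) (π : Equiv.Perm (Fin N)) :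
    tensorPow (2 * k) (B π) =
      (tensorSum k (B π)).submatrix (tupleEquiv N k) (tupleEquiv N k) := by
  ext i j
  simp only [tensorPow, Matrix.of_apply, tensorSum, B_map_star, Matrix.submatrix_apply,
    tensor_apply]
  rw [← Equiv.prod_comp (finSumFinEquiv.trans (finCongr (two_mul k).symm))]
  refine Finset.prod_congr rfl fun x _ => ?_
  rcases x with x | x <;> rfl

theorem schattenInf_submatrix_le {m n : Type*} [Fintype m] [DecidableEq m] [Fintype n]
    [DecidableEq n] (e : m ≃ n) (A : Matrix n n ℂ) :
    schattenInf (A.submatrix e e) ≤ schattenInf A := by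
  refine ContinuousLinearMap.opNorm_le_bound _ (norm_nonneg _) fun v => ?_
  have hn : ∀ w : n → ℂ, ‖WithLp.toLp 2 (w ∘ e)‖ = ‖WithLp.toLp 2 w‖ := by
    intro w
    simp only [EuclideanSpace.norm_eq, Function.comp]
    rw [Equiv.sum_comp e (fun x => ‖w x‖ ^ 2)]
  have hv : v = WithLp.toLp 2 ((v.ofLp ∘ e.symm) ∘ e) := by
    ext x; simp
  have h : Matrix.toEuclideanCLM (𝕜 := ℂ) (A.submatrix e e) v =
      WithLp.toLp 2 ((A.mulVec (v.ofLp ∘ e.symm)) ∘ e) := by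
    ext x
    rw [Matrix.ofLp_toEuclideanCLM, Matrix.submatrix_mulVec_equiv]
  rw [h, hn]
  conv_rhs => rw [hv, hn]
  rw [← Matrix.toEuclideanCLM_toLp]
  exact ContinuousLinearMap.le_opNorm _ _

theorem schattenInf_submatrix {m n : Type*} [Fintype m] [DecidableEq m] [Fintype n] [DecidableEq n]
    (e : m ≃ n) (A : Matrix n n ℂ) : schattenInf (A.submatrix e e) = schattenInf A := by
  refine le_antisymm (schattenInf_submatrix_le e A) ?_
  simpa using schattenInf_submatrix_le e.symm (A.submatrix e e)

/-! ### The Haar average as an orthogonal projection. -/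

section Haar

theorem tensorSum_inv (k : ℕ) (V : U N) :
    tensorSum k ((V⁻¹ : U N) : Matrix (Fin N) (Fin N) ℂ) =
      star (tensorSum k (V : Matrix _ _ ℂ)) := by
  rw [← tensorSum_star]
  rfl

instance : IsProbabilityMeasure (haar N) :=
  ⟨by
    simpa [haar] using Measure.haarMeasure_self
      (K₀ := (⊤ : TopologicalSpace.PositiveCompacts (U N)))⟩

instance : (haar N).IsMulLeftInvariant := by
  unfold haar; infer_instance

theorem continuous_tensorSum_apply (k : ℕ) (i j : Fin k ⊕ Fin k → Fin N) :
    Continuous fun V : U N => tensorSum k (V : Matrix (Fin N) (Fin N) ℂ) i j := by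
  have h : ∀ a b, Continuous fun V : U N => (V : Matrix (Fin N) (Fin N) ℂ) a b := fun a b =>
    (continuous_apply_apply a b).comp continuous_subtype_val
  simp_rw [tensorSum_apply_elim]
  exact (continuous_finsetProd _ fun x _ => h _ _).mul
    (continuous_finsetProd _ fun x _ => (h _ _).star)

theorem integrable_tensorSum_apply (k : ℕ) (i j : Fin k ⊕ Fin k → Fin N) (μ : Measure (U N))
    [IsFiniteMeasure μ] :
    Integrable (fun V : U N => tensorSum k (V : Matrix (Fin N) (Fin N) ℂ) i j) μ :=
  (continuous_tensorSum_apply k i j).integrable_of_hasCompactSupport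
    (HasCompactSupport.of_compactSpace _)

/-- The Haar average of `V^{⊗k,k}`. -/
def haarMoment (N k : ℕ) : Matrix (Fin k ⊕ Fin k → Fin N) (Fin k ⊕ Fin k → Fin N) ℂ :=
  Matrix.of fun i j => ∫ V : U N, tensorSum k (V : Matrix (Fin N) (Fin N) ℂ) i j ∂haar N

theorem mul_haarMoment (k : ℕ) (A : Matrix (Fin k ⊕ Fin k → Fin N) (Fin k ⊕ Fin k → Fin N) ℂ)
    (i j : Fin k ⊕ Fin k → Fin N) : (A * haarMoment N k) i j =
      ∫ V : U N, (A * tensorSum k (V : Matrix (Fin N) (Fin N) ℂ)) i j ∂haar N := by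
  simp only [Matrix.mul_apply, haarMoment, Matrix.of_apply]
  rw [integral_finsetSum _ fun l _ => (integrable_tensorSum_apply k l j _).const_mul _]
  simp_rw [integral_const_mul]

theorem tensorSum_mul_haarMoment (k : ℕ) (W : U N) :
    tensorSum k (W : Matrix (Fin N) (Fin N) ℂ) * haarMoment N k = haarMoment N k := by
  ext i j
  rw [mul_haarMoment]
  simp_rw [← tensorSum_mul]
  exact integral_mul_left_eq_self (μ := haar N)
    (fun V : U N => tensorSum k (V : Matrix (Fin N) (Fin N) ℂ) i j) W

theorem mul_haarMoment_of_fixed (k : ℕ)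
    (A : Matrix (Fin k ⊕ Fin k → Fin N) (Fin k ⊕ Fin k → Fin N) ℂ)
    (hA : ∀ V : U N, A * tensorSum k (V : Matrix (Fin N) (Fin N) ℂ) = A) :
    A * haarMoment N k = A := by
  ext i j
  rw [mul_haarMoment]
  simp [hA]

theorem star_haarMoment_mul_tensorSum (k : ℕ) (W : U N) :
    star (haarMoment N k) * tensorSum k (W : Matrix (Fin N) (Fin N) ℂ) = star (haarMoment N k) := by
  have h := congrArg star (tensorSum_mul_haarMoment k W⁻¹)
  rwa [star_mul, tensorSum_inv, star_star] at h

/-- Only left invariance enters: `G* V = G*` for every `V` integrates to `G* G = G*`, and the left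
side is self-adjoint. -/
theorem isSelfAdjoint_haarMoment (k : ℕ) : IsSelfAdjoint (haarMoment N k) := by
  have h := mul_haarMoment_of_fixed k _ (star_haarMoment_mul_tensorSum (N := N) k)
  have h' := congrArg star h
  rw [star_mul, star_star, h] at h'
  exact h'

theorem haarMoment_mul_tensorSum (k : ℕ) (W : U N) :
    haarMoment N k * tensorSum k (W : Matrix (Fin N) (Fin N) ℂ) = haarMoment N k := by
  have h := star_haarMoment_mul_tensorSum k W
  rwa [(isSelfAdjoint_haarMoment k).star_eq] at h

theorem haarMoment_mul_self (k : ℕ) : haarMoment N k * haarMoment N k = haarMoment N k :=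
  mul_haarMoment_of_fixed k _ (haarMoment_mul_tensorSum k)

theorem quantumMoment_haar (k : ℕ) :
    quantumMoment k (haar N) = (haarMoment N k).submatrix (Equiv.sumArrowEquivProdArrow _ _ _).symm
      (Equiv.sumArrowEquivProdArrow _ _ _).symm := by
  ext i j
  simp only [quantumMoment, tensorPow₂_eq_submatrix, haarMoment]
  rfl

end Haar

/-! ### Averages over permutations. -/

section Perm

/-- The average of `B(π)^{⊗k,k}` over a distribution on permutations. -/
def permMoment (k : ℕ) (ν : PMF (Equiv.Perm (Fin N))) :
    Matrix (Fin k ⊕ Fin k → Fin N) (Fin k ⊕ Fin k → Fin N) ℂ :=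
  ∑ π, (ν π).toReal • tensorSum k (B π)

theorem sum_toReal_eq_one {α : Type*} [Fintype α] (ν : PMF α) : ∑ a, (ν a).toReal = 1 := by
  rw [← ENNReal.toReal_sum fun a _ => ν.apply_ne_top a, ← tsum_fintype (L := .unconditional _),
    ν.tsum_coe, ENNReal.toReal_one]

theorem classicalMoment_eq_submatrix (k : ℕ) (ν : PMF (Equiv.Perm (Fin N))) :
    classicalMoment (2 * k) ν =
      (permMoment k ν).submatrix (tupleEquiv N k) (tupleEquiv N k) := by
  ext i j
  simp [classicalMoment, permMoment, tensorPow_B_eq_submatrix, Matrix.sum_apply]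

theorem B_mul (π τ : Equiv.Perm (Fin N)) : B (π * τ) = B π * B τ := by
  ext a b
  simp only [B, Matrix.mul_apply, Matrix.of_apply, Equiv.Perm.mul_apply, mul_ite, mul_one, mul_zero,
    Finset.sum_ite_eq', Finset.mem_univ, if_true]
  rfl

theorem star_B (π : Equiv.Perm (Fin N)) : star (B π) = B π⁻¹ := by
  ext a b
  simp only [B, Matrix.star_apply, Matrix.of_apply, apply_ite star, star_one, star_zero,
    Equiv.Perm.eq_inv_iff_eq]
  congr 1
  exact propext eq_comm

theorem permMoment_mul_of_fixed (k : ℕ) (ν : PMF (Equiv.Perm (Fin N)))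
    (A : Matrix (Fin k ⊕ Fin k → Fin N) (Fin k ⊕ Fin k → Fin N) ℂ)
    (hA : ∀ π, tensorSum k (B π) * A = A) : permMoment k ν * A = A := by
  rw [permMoment, Finset.sum_mul]
  simp_rw [smul_mul_assoc, hA]
  rw [← Finset.sum_smul, sum_toReal_eq_one, one_smul]

theorem mul_permMoment_of_fixed (k : ℕ) (ν : PMF (Equiv.Perm (Fin N)))
    (A : Matrix (Fin k ⊕ Fin k → Fin N) (Fin k ⊕ Fin k → Fin N) ℂ)
    (hA : ∀ π, A * tensorSum k (B π) = A) : A * permMoment k ν = A := by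
  rw [permMoment, Finset.mul_sum]
  simp_rw [mul_smul_comm, hA]
  rw [← Finset.sum_smul, sum_toReal_eq_one, one_smul]

/-- The average of `B(π)^{⊗k,k}` over all permutations. -/
abbrev unifMoment (N k : ℕ) : Matrix (Fin k ⊕ Fin k → Fin N) (Fin k ⊕ Fin k → Fin N) ℂ :=
  permMoment k (PMF.uniformOfFintype (Equiv.Perm (Fin N)))

theorem tensorSum_B_mul_unifMoment (k : ℕ) (π : Equiv.Perm (Fin N)) :
    tensorSum k (B π) * unifMoment N k = unifMoment N k := by
  simp only [unifMoment, permMoment, PMF.uniformOfFintype_apply, Finset.mul_sum, mul_smul_comm,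
    ← tensorSum_mul, ← B_mul]
  exact Equiv.sum_comp (Equiv.mulLeft π) fun τ => (_ : ℝ) • tensorSum k (B τ)

theorem unifMoment_mul_tensorSum_B (k : ℕ) (π : Equiv.Perm (Fin N)) :
    unifMoment N k * tensorSum k (B π) = unifMoment N k := by
  simp only [unifMoment, permMoment, PMF.uniformOfFintype_apply, Finset.sum_mul, smul_mul_assoc,
    ← tensorSum_mul, ← B_mul]
  exact Equiv.sum_comp (Equiv.mulRight π) fun τ => (_ : ℝ) • tensorSum k (B τ)

theorem isSelfAdjoint_unifMoment (k : ℕ) : IsSelfAdjoint (unifMoment N k) := by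
  rw [IsSelfAdjoint]
  simp only [unifMoment, permMoment, PMF.uniformOfFintype_apply, star_sum, star_smul, star_trivial,
    ← tensorSum_star, star_B]
  exact Equiv.sum_comp (Equiv.inv _) fun τ => (_ : ℝ) • tensorSum k (B τ)

end Perm

/-! ### Euclidean norms of functions on a finite set. -/

section L2

variable {X : Type*} [Fintype X]

/-- The Euclidean norm of a complex function on a finite set. -/
abbrev l2 (u : X → ℂ) : ℝ := ‖WithLp.toLp 2 u‖

theorem l2_eq (u : X → ℂ) : l2 u = √(∑ i, ‖u i‖ ^ 2) := EuclideanSpace.norm_eq _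

theorem l2_sq (u : X → ℂ) : l2 u ^ 2 = ∑ i, ‖u i‖ ^ 2 := EuclideanSpace.norm_sq_eq _

theorem norm_dotProduct_le (u v : X → ℂ) : ‖u ⬝ᵥ v‖ ≤ l2 u * l2 v := by
  rw [l2_eq, l2_eq]
  refine (norm_sum_le _ _).trans ?_
  simp_rw [norm_mul]
  exact Real.sum_mul_le_sqrt_mul_sqrt _ _ _

theorem l2_star (u : X → ℂ) : l2 (star u) = l2 u := by
  simp [l2_eq]

theorem l2_mulVec_of_unitary [DecidableEq X] {A : Matrix X X ℂ} (hA : star A * A = 1) (u : X → ℂ) :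
    l2 (A.mulVec u) = l2 u := by
  have h : ∀ v : X → ℂ, ((l2 v ^ 2 : ℝ) : ℂ) = star v ⬝ᵥ v := by
    intro v
    rw [l2_sq, dotProduct]
    push_cast
    refine Finset.sum_congr rfl fun i _ => ?_
    rw [Pi.star_apply, RCLike.star_def, RCLike.conj_mul]; rfl
  have : l2 (A.mulVec u) ^ 2 = l2 u ^ 2 := by
    rw [← Complex.ofReal_inj, h, h, Matrix.star_mulVec, Matrix.dotProduct_mulVec,
      Matrix.vecMul_vecMul, ← Matrix.star_eq_conjTranspose, hA, Matrix.vecMul_one]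
  exact (sq_eq_sq₀ (norm_nonneg _) (norm_nonneg _)).1 this

end L2

/-! ### Roots of unity and the entries of the Fourier matrix. -/

section Roots

variable {N : ℕ}

theorem pow_val_add {ζ : ℂ} (hζ : ζ ^ N = 1) (s t : Fin N) :
    ζ ^ ((s + t : Fin N) : ℕ) = ζ ^ (s : ℕ) * ζ ^ (t : ℕ) := by
  rw [Fin.val_add, ← pow_add]
  exact (pow_eq_pow_mod _ hζ).symm

theorem sum_pow_eq {z : ℂ} (hz : z ^ N = 1) :
    ∑ t : Fin N, z ^ (t : ℕ) = if z = 1 then (N : ℂ) else 0 := by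
  rw [Fin.sum_univ_eq_sum_range (fun i => z ^ i) N]
  split_ifs with h
  · simp [h]
  · have hg := geom_sum_mul z N
    rw [hz, sub_self] at hg
    exact (mul_eq_zero.mp hg).resolve_right (sub_ne_zero.mpr h)

theorem card_mul_pow_eq_one_le {ζ : ℂ} (hζ : IsPrimitiveRoot ζ N) (c : ℂ) {s : ℕ}
    (hs : 0 < s) : (Finset.univ.filter fun t : Fin N => c * (ζ ^ (t : ℕ)) ^ s = 1).card ≤ s := by
  refine le_trans ?_ (Polynomial.card_nthRoots s c⁻¹)
  refine le_trans ?_ (Multiset.toFinset_card_le _)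
  refine Finset.card_le_card_of_injOn (fun t => ζ ^ (t : ℕ)) ?_ ?_
  · intro t ht
    simp only [Finset.coe_filter, Finset.mem_univ, true_and, Set.mem_ofPred_eq] at ht
    simp only [Finset.mem_coe, Multiset.mem_toFinset, Polynomial.mem_nthRoots hs]
    exact eq_inv_of_mul_eq_one_right ht
  · intro t _ t' _ h
    exact Fin.ext (hζ.pow_inj t.2 t'.2 h)

theorem isPrimitiveRoot_star {ζ : ℂ} (hζ : IsPrimitiveRoot ζ N) : IsPrimitiveRoot (star ζ) N :=
  hζ.map_of_injective (f := starRingEnd ℂ) (RingHom.injective _)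

/-- The root of unity `e^{2πi/N}`. -/
def rootN (N : ℕ) : ℂ := Complex.exp (2 * Real.pi * Complex.I / N)

theorem fourier_apply (m n : Fin N) : fourier N m n =
    (1 / (Real.sqrt N : ℂ)) * (rootN N) ^ (((m : ℕ) + 1) * ((n : ℕ) + 1)) := rfl

theorem fourier_comm (m n : Fin N) : fourier N m n = fourier N n m := by
  rw [fourier_apply, fourier_apply, mul_comm (_ + 1)]

variable [NeZero N]

theorem isPrimitiveRoot_rootN : IsPrimitiveRoot (rootN N) N :=
  Complex.isPrimitiveRoot_exp N (NeZero.ne N)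

/-- Each row is a character up to a constant. The addition is modulo `N`, and the exponent `m + 1`
reflects labels running from `1` to `N`. -/
theorem fourier_add (m n t : Fin N) : fourier N m (n + t) =
    fourier N m n * ((rootN N) ^ ((m : ℕ) + 1)) ^ (t : ℕ) := by
  have h : (rootN N ^ ((m : ℕ) + 1)) ^ N = 1 := by
    rw [← pow_mul, mul_comm, pow_mul, isPrimitiveRoot_rootN.pow_eq_one, one_pow]
  rw [fourier_apply, fourier_apply, pow_mul, pow_succ, pow_val_add h, pow_mul, pow_succ (_ ^ _)]
  ring

theorem norm_fourier_apply (m n : Fin N) : ‖fourier N m n‖ = 1 / √N := by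
  rw [fourier_apply, norm_mul, norm_pow, isPrimitiveRoot_rootN.norm'_eq_one (NeZero.ne N), one_pow,
    mul_one, norm_div, norm_one, Complex.norm_real, Real.norm_of_nonneg (Real.sqrt_nonneg _)]

end Roots

/-! ### Shifting a block of tensor factors. -/

section Shift

variable {N : ℕ} {ι : Type*}

/-- The product of `ζ ^ (m x + 1)` over `x ∈ S`. -/
def phase (ζ : ℂ) (S : Finset ι) (m : ι → Fin N) : ℂ := ∏ x ∈ S, ζ ^ ((m x : ℕ) + 1)

theorem phase_pow {ζ : ℂ} (hζ : ζ ^ N = 1) (S : Finset ι) (m : ι → Fin N) :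
    phase ζ S m ^ N = 1 := by
  rw [phase, ← Finset.prod_pow]
  refine Finset.prod_eq_one fun x _ => ?_
  rw [← pow_mul, mul_comm, pow_mul, hζ, one_pow]

theorem phase_add_const {ζ : ℂ} (hζ : ζ ^ N = 1) (S : Finset ι) (m : ι → Fin N) (t : Fin N) :
    phase ζ S (m + fun _ => t) = phase ζ S m * (ζ ^ (t : ℕ)) ^ S.card := by
  rw [phase, phase, ← Finset.prod_const, ← Finset.prod_mul_distrib]
  refine Finset.prod_congr rfl fun x _ => ?_
  rw [Pi.add_apply, pow_succ, pow_val_add hζ, pow_succ]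
  ring

/-- In a translation-invariant set of tuples, few have phase one. -/
theorem card_phase_eq_one_le [NeZero N] {ζ : ℂ} (hζ : IsPrimitiveRoot ζ N) {S : Finset ι}
    (hS : S.Nonempty) (A : Finset (ι → Fin N)) (hA : ∀ m t, (m + fun _ => t) ∈ A ↔ m ∈ A) :
    N * (A.filter fun m => phase ζ S m = 1).card ≤ S.card * A.card := by
  classical
  -- Translating the whole tuple by `t` permutes `A` and multiplies the phase by `ζ ^ (t * |S|)`.
  -- Counting pairs `(m, t)` then leaves, for each `m`, an equation of degree `|S|` in `ζ ^ t`.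
  have h1 : ∀ t : Fin N, (A.filter fun m => phase ζ S m = 1).card =
      (A.filter fun m => phase ζ S m * (ζ ^ (t : ℕ)) ^ S.card = 1).card := by
    intro t
    symm
    refine Finset.card_equiv (Equiv.addRight fun _ => t) fun m => ?_
    simp only [Finset.mem_filter, Equiv.coe_addRight, hA, phase_add_const hζ.pow_eq_one]
  calc N * (A.filter fun m => phase ζ S m = 1).card
      = ∑ t : Fin N, (A.filter fun m => phase ζ S m * (ζ ^ (t : ℕ)) ^ S.card = 1).card := by
        rw [← Finset.sum_congr rfl fun t _ => h1 t]; simp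
    _ = ∑ m ∈ A, (Finset.univ.filter fun t : Fin N =>
          phase ζ S m * (ζ ^ (t : ℕ)) ^ S.card = 1).card := by
        simp_rw [Finset.card_filter]
        exact Finset.sum_comm
    _ ≤ ∑ m ∈ A, S.card := Finset.sum_le_sum fun m _ =>
        card_mul_pow_eq_one_le hζ _ hS.card_pos
    _ = _ := by simp [mul_comm]

variable [Fintype ι] [DecidableEq ι] [NeZero N]

/-- The tuple with entry `t` at the places in `S`, and zero elsewhere. -/
def shiftBy (S : Finset ι) (t : Fin N) : ι → Fin N := fun x => if x ∈ S then t else 0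

theorem tensor_add_shiftBy {K : ι → Matrix (Fin N) (Fin N) ℂ} {ζ : ℂ} {S : Finset ι}
    (hK : ∀ x ∈ S, ∀ m n t, K x m (n + t) = K x m n * (ζ ^ ((m : ℕ) + 1)) ^ (t : ℕ))
    (m i : ι → Fin N) (t : Fin N) :
    tensor K m (i + shiftBy S t) = tensor K m i * phase ζ S m ^ (t : ℕ) := by
  rw [tensor_apply, tensor_apply, phase, ← Finset.prod_pow,
    ← Fintype.prod_ite_mem S, ← Finset.prod_mul_distrib]
  refine Finset.prod_congr rfl fun x _ => ?_
  by_cases hx : x ∈ S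
  · simp [shiftBy, hx, hK x hx]
  · simp [shiftBy, hx]

/-- The average of a function over the shifts of the places in `S`. -/
def shiftAverage (S : Finset ι) (u : (ι → Fin N) → ℂ) : (ι → Fin N) → ℂ :=
  fun i => (N : ℂ)⁻¹ * ∑ t, u (i - shiftBy S t)

/-- Shifting the input along `S` multiplies output `m` by a power of its phase on `S`, an `N`-th
root of unity; averaging over all shifts annihilates every output whose phase is not `1`. -/
theorem tensor_mulVec_shiftAverage {K : ι → Matrix (Fin N) (Fin N) ℂ} {ζ : ℂ} (hζ : ζ ^ N = 1)
    {S : Finset ι}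
    (hK : ∀ x ∈ S, ∀ m n t, K x m (n + t) = K x m n * (ζ ^ ((m : ℕ) + 1)) ^ (t : ℕ))
    (u : (ι → Fin N) → ℂ) (m : ι → Fin N) :
    (tensor K).mulVec (shiftAverage S u) m =
      if phase ζ S m = 1 then (tensor K).mulVec u m else 0 := by
  have hN : (N : ℂ) ≠ 0 := Nat.cast_ne_zero.2 (NeZero.ne N)
  have h1 : ∀ t : Fin N, ∑ i, tensor K m i * u (i - shiftBy S t) =
      phase ζ S m ^ (t : ℕ) * (tensor K).mulVec u m := by
    intro t
    rw [← Equiv.sum_comp (Equiv.addRight (shiftBy S t)), Matrix.mulVec, dotProduct, Finset.mul_sum]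
    refine Finset.sum_congr rfl fun i _ => ?_
    rw [Equiv.coe_addRight, tensor_add_shiftBy hK, add_sub_cancel_right]
    ring
  calc (tensor K).mulVec (shiftAverage S u) m
      = ∑ i, ∑ t, (N : ℂ)⁻¹ * (tensor K m i * u (i - shiftBy S t)) := by
        refine Finset.sum_congr rfl fun i _ => ?_
        rw [shiftAverage, Finset.mul_sum, Finset.mul_sum]
        exact Finset.sum_congr rfl fun t _ => by ring
    _ = (N : ℂ)⁻¹ * ∑ t : Fin N, phase ζ S m ^ (t : ℕ) * (tensor K).mulVec u m := by
        rw [Finset.sum_comm, Finset.mul_sum]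
        exact Finset.sum_congr rfl fun t _ => by rw [← Finset.mul_sum, h1]
    _ = _ := by
        rw [← Finset.sum_mul, sum_pow_eq (phase_pow hζ S m)]
        split_ifs
        · field_simp
        · simp

end Shift

/-! ### Coincidence patterns of tuples and almost invariance under block shifts. -/

section KerClass

variable {N : ℕ} {ι : Type*} [Fintype ι] [DecidableEq ι]

open Classical in
/-- The tuples whose coincidence pattern is the partition `r`. -/
def kerClass (N : ℕ) (r : Setoid ι) : Finset (ι → Fin N) :=
  Finset.univ.filter fun i => Setoid.ker i = r

theorem mem_kerClass {r : Setoid ι} {i : ι → Fin N} : i ∈ kerClass N r ↔ Setoid.ker i = r := by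
  simp [kerClass]

theorem add_const_mem_kerClass {r : Setoid ι} (m : ι → Fin N) (t : Fin N) :
    (m + fun _ => t) ∈ kerClass N r ↔ m ∈ kerClass N r := by
  have : Setoid.ker (m + fun _ => t) = Setoid.ker m := by
    ext a b
    simp [Setoid.ker_def]
  rw [mem_kerClass, mem_kerClass, this]

/-- A partition with a set of representatives of size `s` is the pattern of at most `N ^ s`
tuples. -/
theorem card_kerClass_le {r : Setoid ι} (T : Finset ι) (hT : ∀ x, ∃ y ∈ T, r x y) :
    (kerClass N r).card ≤ N ^ T.card := by
  have : (kerClass N r).card ≤ (Finset.univ : Finset (T → Fin N)).card := by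
    refine Finset.card_le_card_of_injOn (fun i x => i x)
      (fun _ _ => Finset.mem_coe.2 (Finset.mem_univ _)) ?_
    intro i hi j hj h
    have hi' := mem_kerClass.1 hi
    have hj' := mem_kerClass.1 hj
    funext x
    obtain ⟨y, hy, hxy⟩ := hT x
    have h1 : i x = i y := by rw [← Setoid.ker_def, hi']; exact hxy
    have h2 : j x = j y := by rw [← Setoid.ker_def, hj']; exact hxy
    rw [h1, h2]
    exact congrFun h ⟨y, hy⟩
  simpa using this

variable [NeZero N]

/-- Moving the common value of a whole block can spoil the pattern only by hitting a value already
present in the tuple, so there are at most as many bad shifts as tensor factors. -/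
theorem exists_eq_of_add_shiftBy_notMem {r : Setoid ι} {S : Finset ι} {x₀ : ι}
    (hS : ∀ x, x ∈ S ↔ r x x₀) {i : ι → Fin N} (hi : i ∈ kerClass N r) {t : Fin N}
    (h : i + shiftBy S t ∉ kerClass N r) : ∃ y, i y = i x₀ + t := by
  by_contra! hne
  apply h
  rw [mem_kerClass] at hi ⊢
  have hS' : ∀ x, x ∈ S ↔ i x = i x₀ := fun x => by rw [hS, ← hi, Setoid.ker_def]
  rw [← hi]
  ext a b
  simp only [Setoid.ker_def, Pi.add_apply, shiftBy]
  by_cases ha : a ∈ S <;> by_cases hb : b ∈ S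
  · simp [ha, hb]
  · have h1 := (hS' a).1 ha
    have h2 := fun h => hb ((hS' b).2 h)
    simp only [ha, hb, if_true, if_false, add_zero, h1]
    exact ⟨fun h => absurd h.symm (hne b), fun h => absurd h.symm h2⟩
  · have h1 := (hS' b).1 hb
    have h2 := fun h => ha ((hS' a).2 h)
    simp only [ha, hb, if_true, if_false, add_zero, h1]
    exact ⟨fun h => absurd h (hne a), fun h => absurd h h2⟩
  · simp [ha, hb]

theorem card_add_shiftBy_notMem_le {r : Setoid ι} {S : Finset ι} {x₀ : ι}
    (hS : ∀ x, x ∈ S ↔ r x x₀) {i : ι → Fin N} (hi : i ∈ kerClass N r) :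
    (Finset.univ.filter fun t : Fin N => i + shiftBy S t ∉ kerClass N r).card ≤
      Fintype.card ι := by
  classical
  refine le_trans (Finset.card_le_card ?_)
    (Finset.card_image_le (s := Finset.univ) (f := fun y => i y - i x₀))
  intro t ht
  obtain ⟨y, hy⟩ := exists_eq_of_add_shiftBy_notMem hS hi (Finset.mem_filter.1 ht).2
  exact Finset.mem_image.2 ⟨y, Finset.mem_univ _, by rw [hy]; abel⟩

theorem card_sub_shiftBy_notMem_le {r : Setoid ι} {S : Finset ι} {x₀ : ι}
    (hS : ∀ x, x ∈ S ↔ r x x₀) {i : ι → Fin N} (hi : i ∈ kerClass N r) :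
    (Finset.univ.filter fun t : Fin N => i - shiftBy S t ∉ kerClass N r).card ≤
      Fintype.card ι := by
  refine le_trans (le_of_eq ?_) (card_add_shiftBy_notMem_le hS hi)
  refine Finset.card_equiv (Equiv.neg _) fun t => ?_
  have : i + shiftBy S (-t) = i - shiftBy S t := by
    funext x
    by_cases hx : x ∈ S <;> simp [shiftBy, hx, sub_eq_add_neg]
  simp [this]

/-- The indicator function of a set of tuples. -/
def ind {X : Type*} [DecidableEq X] (A : Finset X) : X → ℂ := fun i => if i ∈ A then 1 else 0

theorem l2_ind {X : Type*} [Fintype X] [DecidableEq X] (A : Finset X) : l2 (ind A) = √A.card := by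
  rw [l2_eq]
  congr 1
  simp [ind, apply_ite]

theorem norm_inv_mul_sum_sq_le (f : Fin N → ℂ) :
    ‖(N : ℂ)⁻¹ * ∑ t, f t‖ ^ 2 ≤ (N : ℝ)⁻¹ * ∑ t, ‖f t‖ ^ 2 := by
  have hN : (0 : ℝ) < N := Nat.cast_pos.2 (NeZero.pos N)
  have h1 : ‖∑ t, f t‖ ^ 2 ≤ N * ∑ t, ‖f t‖ ^ 2 := by
    calc ‖∑ t, f t‖ ^ 2 ≤ (∑ t, ‖f t‖) ^ 2 := by gcongr; exact norm_sum_le _ _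
      _ ≤ _ := by simpa using sq_sum_le_card_mul_sum_sq (s := Finset.univ) (f := fun t => ‖f t‖)
  rw [norm_mul, norm_inv, Complex.norm_natCast, mul_pow]
  calc ((N : ℝ)⁻¹) ^ 2 * ‖∑ t, f t‖ ^ 2 ≤ ((N : ℝ)⁻¹) ^ 2 * (N * ∑ t, ‖f t‖ ^ 2) := by gcongr
    _ = _ := by field_simp

/-- By convexity the left side is at most `1/N` times the number of pairs `(i, t)` for which exactly
one of `i` and its shift has pattern `r`. Each of the two directions contributes at most `|ι|`
shifts per tuple of the class. -/
theorem l2_ind_sub_shiftAverage_sq_le {r : Setoid ι} {S : Finset ι} {x₀ : ι}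
    (hS : ∀ x, x ∈ S ↔ r x x₀) :
    l2 (ind (kerClass N r) - shiftAverage S (ind (kerClass N r))) ^ 2 ≤
      2 * Fintype.card ι / N * (kerClass N r).card := by
  set A := kerClass N r with hA
  have hN : (0 : ℝ) < N := Nat.cast_pos.2 (NeZero.pos N)
  have hpt : ∀ i, ‖(ind A - shiftAverage S (ind A)) i‖ ^ 2 ≤
      (N : ℝ)⁻¹ * ∑ t, ‖ind A i - ind A (i - shiftBy S t)‖ ^ 2 := by
    intro i
    refine le_trans (le_of_eq ?_) (norm_inv_mul_sum_sq_le _)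
    congr 2
    rw [Finset.sum_sub_distrib, mul_sub, Pi.sub_apply, shiftAverage]
    congr 1
    have : (N : ℂ) ≠ 0 := Nat.cast_ne_zero.2 (NeZero.ne N)
    simp [this]
  have hsplit : ∀ i (t : Fin N), ‖ind A i - ind A (i - shiftBy S t)‖ ^ 2 =
      (if i ∈ A then if i - shiftBy S t ∉ A then (1 : ℝ) else 0 else 0) +
      (if i - shiftBy S t ∈ A then if i ∉ A then (1 : ℝ) else 0 else 0) := by
    intro i t
    by_cases h1 : i ∈ A <;> by_cases h2 : i - shiftBy S t ∈ A <;> simp [ind, h1, h2]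
  have hfst : ∑ i, ∑ t : Fin N, (if i ∈ A then if i - shiftBy S t ∉ A then (1 : ℝ) else 0 else 0) ≤
      Fintype.card ι * A.card := by
    have : ∀ i, ∑ t : Fin N, (if i ∈ A then if i - shiftBy S t ∉ A then (1 : ℝ) else 0 else 0) ≤
        if i ∈ A then (Fintype.card ι : ℝ) else 0 := by
      intro i
      split_ifs with hi
      · rw [Finset.sum_boole]
        exact_mod_cast card_sub_shiftBy_notMem_le hS hi
      · simp
    refine (Finset.sum_le_sum fun i _ => this i).trans (le_of_eq ?_)
    simp [mul_comm]
  have hsnd : ∑ i, ∑ t : Fin N, (if i - shiftBy S t ∈ A then if i ∉ A then (1 : ℝ) else 0 else 0) ≤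
      Fintype.card ι * A.card := by
    rw [Finset.sum_comm]
    have h1 : ∀ t : Fin N,
        ∑ i, (if i - shiftBy S t ∈ A then if i ∉ A then (1 : ℝ) else 0 else 0) =
        ∑ i, (if i ∈ A then if i + shiftBy S t ∉ A then (1 : ℝ) else 0 else 0) := by
      intro t
      rw [← Equiv.sum_comp (Equiv.addRight (shiftBy S t))]
      refine Finset.sum_congr rfl fun i _ => ?_
      rw [Equiv.coe_addRight, add_sub_cancel_right]
    rw [Finset.sum_congr rfl fun t _ => h1 t, Finset.sum_comm]
    have : ∀ i, ∑ t : Fin N, (if i ∈ A then if i + shiftBy S t ∉ A then (1 : ℝ) else 0 else 0) ≤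
        if i ∈ A then (Fintype.card ι : ℝ) else 0 := by
      intro i
      split_ifs with hi
      · rw [Finset.sum_boole]
        exact_mod_cast card_add_shiftBy_notMem_le hS hi
      · simp
    refine (Finset.sum_le_sum fun i _ => this i).trans (le_of_eq ?_)
    simp [mul_comm]
  rw [l2_sq]
  calc ∑ i, ‖(ind A - shiftAverage S (ind A)) i‖ ^ 2
      ≤ ∑ i, (N : ℝ)⁻¹ * ∑ t, ‖ind A i - ind A (i - shiftBy S t)‖ ^ 2 :=
        Finset.sum_le_sum fun i _ => hpt i
    _ ≤ (N : ℝ)⁻¹ * (Fintype.card ι * A.card + Fintype.card ι * A.card) := by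
        rw [← Finset.mul_sum]
        simp_rw [hsplit, Finset.sum_add_distrib]
        gcongr
    _ = _ := by field_simp; ring

/-- A block of `r` on which the tensor factors are characters of one sign makes the sum of the
matrix entries over `A × kerClass N r` small. -/
theorem norm_overlap_le_of_block {K : ι → Matrix (Fin N) (Fin N) ℂ}
    (hK : star (tensor K) * tensor K = 1) {ζ : ℂ} (hζ : IsPrimitiveRoot ζ N)
    {r : Setoid ι} {S : Finset ι} {x₀ : ι} (hS : ∀ x, x ∈ S ↔ r x x₀)
    (hKS : ∀ x ∈ S, ∀ m n t, K x m (n + t) = K x m n * (ζ ^ ((m : ℕ) + 1)) ^ (t : ℕ))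
    (A : Finset (ι → Fin N)) (hA : ∀ m t, (m + fun _ => t) ∈ A ↔ m ∈ A) :
    ‖ind A ⬝ᵥ (tensor K).mulVec (ind (kerClass N r))‖ ≤
      (√(S.card) + √(2 * Fintype.card ι)) / √N * √A.card * √(kerClass N r).card := by
  classical
  have hN : (0 : ℝ) < N := Nat.cast_pos.2 (NeZero.pos N)
  set u := ind (kerClass N r) with hu
  set A' := A.filter fun m => phase ζ S m = 1 with hA'
  -- The shift-averaged part of `u` sees only the few `m ∈ A` of phase one; the remainder of `u` is
  -- small in norm. Cauchy–Schwarz and unitarity bound both.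
  have hsplit : ind A ⬝ᵥ (tensor K).mulVec u = ind A' ⬝ᵥ (tensor K).mulVec u +
      ind A ⬝ᵥ (tensor K).mulVec (u - shiftAverage S u) := by
    have h : ind A ⬝ᵥ (tensor K).mulVec (shiftAverage S u) = ind A' ⬝ᵥ (tensor K).mulVec u := by
      refine Finset.sum_congr rfl fun m _ => ?_
      rw [tensor_mulVec_shiftAverage hζ.pow_eq_one hKS]
      by_cases h1 : m ∈ A <;> by_cases h2 : phase ζ S m = 1 <;> simp [ind, hA', h1, h2]
    rw [Matrix.mulVec_sub, dotProduct_sub, h]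
    ring
  have hcard : √(A'.card) ≤ √(S.card) / √N * √(A.card) := by
    rw [← Real.sqrt_div (Nat.cast_nonneg _), ← Real.sqrt_mul (by positivity)]
    apply Real.sqrt_le_sqrt
    rw [div_mul_eq_mul_div, le_div_iff₀ hN, mul_comm]
    exact_mod_cast card_phase_eq_one_le hζ ⟨x₀, (hS x₀).2 (r.refl x₀)⟩ A hA
  have hu2 : l2 (u - shiftAverage S u) ≤ √(2 * Fintype.card ι) / √N * √(kerClass N r).card := by
    rw [← Real.sqrt_div (by positivity), ← Real.sqrt_mul (by positivity)]
    exact Real.le_sqrt_of_sq_le (l2_ind_sub_shiftAverage_sq_le hS)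
  rw [hsplit]
  calc _ ≤ l2 (ind A') * l2 ((tensor K).mulVec u) +
        l2 (ind A) * l2 ((tensor K).mulVec (u - shiftAverage S u)) :=
        (norm_add_le _ _).trans (add_le_add (norm_dotProduct_le _ _) (norm_dotProduct_le _ _))
    _ ≤ √(S.card) / √N * √(A.card) * √(kerClass N r).card +
        √(A.card) * (√(2 * Fintype.card ι) / √N * √(kerClass N r).card) := by
        rw [l2_mulVec_of_unitary hK, l2_mulVec_of_unitary hK, l2_ind, l2_ind, l2_ind]
        gcongr
    _ = _ := by ring

end KerClass

/-! ### Fourier overlaps of two coincidence patterns. -/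

section Overlap

variable {N k : ℕ}

/-- The partition of `Fin k ⊕ Fin k` into the pairs `{inl (σ y), inr y}`. -/
def pairing (σ : Equiv.Perm (Fin k)) : Setoid (Fin k ⊕ Fin k) := Setoid.ker (Sum.elim id σ)

/-- If every block meets both halves, each half is a set of representatives. If no set of fewer than
`k` elements is one, no element of a half is redundant, so each block has exactly one element in
each half, which is the graph of a bijection. -/
theorem exists_block_or_small_or_pairing (r : Setoid (Fin k ⊕ Fin k)) :
    (∃ x₀, ∀ y, ¬ r (.inr y) (.inl x₀)) ∨ (∃ y₀, ∀ x, ¬ r (.inl x) (.inr y₀)) ∨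
      (∃ T : Finset (Fin k ⊕ Fin k), T.card + 1 ≤ k ∧ ∀ x, ∃ y ∈ T, r x y) ∨
      ∃ σ, r = pairing σ := by
  classical
  by_contra! h
  obtain ⟨hl, hr, hT, hσ⟩ := h
  have erase : ∀ (g : Fin k ↪ Fin k ⊕ Fin k) (_ : ∀ x, ∃ y, r x (g y)) (a b : Fin k), a ≠ b →
      ¬ r (g a) (g b) := by
    intro g hg a b hab hrab
    obtain ⟨x, hx⟩ := hT ((Finset.univ.erase a).map g) (by
      rw [Finset.card_map, Finset.card_erase_of_mem (Finset.mem_univ _), Finset.card_univ,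
        Fintype.card_fin]
      have := a.pos
      omega)
    obtain ⟨y, hy⟩ := hg x
    by_cases hya : y = a
    · subst hya
      exact hx (g b) (Finset.mem_map_of_mem _ (by simp [Ne.symm hab])) (r.trans hy hrab)
    · exact hx (g y) (Finset.mem_map_of_mem _ (by simp [hya])) hy
  have hinl : ∀ a b, r (.inl a) (.inl b) → a = b := by
    intro a b hab
    by_contra hne
    refine erase .inl ?_ a b hne hab
    rintro (x | y)
    · exact ⟨x, r.refl _⟩
    · obtain ⟨x, hx⟩ := hr y
      exact ⟨x, r.symm hx⟩
  have hinr : ∀ a b, r (.inr a) (.inr b) → a = b := by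
    intro a b hab
    by_contra hne
    refine erase .inr ?_ a b hne hab
    rintro (x | y)
    · obtain ⟨y, hy⟩ := hl x
      exact ⟨y, r.symm hy⟩
    · exact ⟨y, r.refl _⟩
  choose f hf using hr
  have hinj : Function.Injective f := by
    intro a b hab
    refine hinr a b (r.trans (r.symm (hf a)) ?_)
    rw [hab]; exact hf b
  have hbij : Function.Bijective f := Finite.injective_iff_bijective.1 hinj
  apply hσ (Equiv.ofBijective f hbij)
  refine Setoid.ext fun a b => ?_
  change r a b ↔ Sum.elim id f a = Sum.elim id f b
  rcases a with a | a <;> rcases b with b | b <;> simp only [Sum.elim_inl, Sum.elim_inr, id]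
  · exact ⟨hinl a b, fun h => h ▸ r.refl _⟩
  · exact ⟨fun h => hinl _ _ (r.trans h (r.symm (hf b))), fun h => h ▸ hf b⟩
  · exact ⟨fun h => hinl _ _ (r.trans (hf a) h), fun h => h ▸ r.symm (hf a)⟩
  · exact ⟨fun h => congrArg f (hinr a b h), fun h => hinj h ▸ r.refl _⟩

theorem star_tensorSum_mul_self (V : U N) :
    star (tensorSum k (V : Matrix (Fin N) (Fin N) ℂ)) * tensorSum k V = 1 := by
  rw [← tensorSum_star, ← tensorSum_mul, Matrix.mem_unitaryGroup_iff'.1 V.2, tensorSum_one]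

theorem transpose_tensorSum_fourier :
    (tensorSum k (fourier N)).transpose = tensorSum k (fourier N) := by
  ext i j
  rw [Matrix.transpose_apply, tensorSum_apply_elim, tensorSum_apply_elim]
  simp_rw [fourier_comm (N := N) (j _)]

theorem dotProduct_fourier_comm (u v : (Fin k ⊕ Fin k → Fin N) → ℂ) :
    u ⬝ᵥ (tensorSum k (fourier N)).mulVec v = v ⬝ᵥ (tensorSum k (fourier N)).mulVec u := by
  rw [Matrix.dotProduct_mulVec, ← Matrix.mulVec_transpose, transpose_tensorSum_fourier,
    dotProduct_comm]

variable [NeZero N]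

theorem norm_tensorSum_fourier_apply (i j : Fin k ⊕ Fin k → Fin N) :
    ‖tensorSum k (fourier N) i j‖ = 1 / (N : ℝ) ^ k := by
  rw [tensorSum_apply_elim, norm_mul, norm_prod, norm_prod]
  simp_rw [norm_star, norm_fourier_apply]
  rw [Finset.prod_const, Finset.card_univ, Fintype.card_fin, ← mul_pow, div_mul_div_comm,
    Real.mul_self_sqrt (Nat.cast_nonneg _), one_mul, div_pow, one_pow]

/-- Sum over two classes with few representatives. -/
theorem norm_overlap_le_of_small {r₁ r₂ : Setoid (Fin k ⊕ Fin k)} {T₁ T₂ : Finset (Fin k ⊕ Fin k)}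
    (hk₁ : T₁.card + 1 ≤ k) (hk₂ : T₂.card + 1 ≤ k)
    (hT₁ : ∀ x, ∃ y ∈ T₁, r₁ x y) (hT₂ : ∀ x, ∃ y ∈ T₂, r₂ x y) :
    ‖ind (kerClass N r₁) ⬝ᵥ (tensorSum k (fourier N)).mulVec (ind (kerClass N r₂))‖ ≤
      1 / √N * √(kerClass N r₁).card * √(kerClass N r₂).card := by
  have hN : (1 : ℝ) ≤ N := Nat.one_le_cast.2 (NeZero.pos N)
  set a : ℝ := ((kerClass N r₁).card : ℝ) with ha
  set b : ℝ := ((kerClass N r₂).card : ℝ) with hb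
  have hsum : ‖ind (kerClass N r₁) ⬝ᵥ (tensorSum k (fourier N)).mulVec (ind (kerClass N r₂))‖ ≤
      1 / (N : ℝ) ^ k * a * b := by
    simp only [dotProduct, Matrix.mulVec, ind, ite_mul, one_mul, zero_mul, mul_ite, mul_one,
      mul_zero, Finset.sum_ite_mem, Finset.univ_inter]
    calc _ ≤ ∑ m ∈ kerClass N r₁, ∑ i ∈ kerClass N r₂, ‖tensorSum k (fourier N) m i‖ :=
          (norm_sum_le _ _).trans (Finset.sum_le_sum fun _ _ => norm_sum_le _ _)
      _ = _ := by
          simp_rw [norm_tensorSum_fourier_apply]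
          simp [ha, hb]
          ring
  have hbound : ∀ {r : Setoid (Fin k ⊕ Fin k)} {T : Finset (Fin k ⊕ Fin k)}, T.card + 1 ≤ k →
      (∀ x, ∃ y ∈ T, r x y) → (N : ℝ) * (kerClass N r).card ≤ N ^ k := by
    intro r T hk hT
    have h1 : N * (kerClass N r).card ≤ N ^ k :=
      calc N * (kerClass N r).card ≤ N * N ^ T.card := by gcongr; exact card_kerClass_le T hT
        _ = N ^ (T.card + 1) := by rw [pow_succ, mul_comm]
        _ ≤ N ^ k := Nat.pow_le_pow_right (NeZero.pos N) hk
    exact_mod_cast h1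
  have h1 := hbound hk₁ hT₁
  have h2 := hbound hk₂ hT₂
  rw [← ha] at h1
  rw [← hb] at h2
  have ha0 : 0 ≤ a := Nat.cast_nonneg _
  have hb0 : 0 ≤ b := Nat.cast_nonneg _
  have hNk : (0 : ℝ) < (N : ℝ) ^ k := by positivity
  -- The inequalities `N a ≤ N ^ k` and `N b ≤ N ^ k` would even give `1/N` in the conclusion;
  -- `1/√N` is enough.
  have hab : √N * (√a * √b) ≤ (N : ℝ) ^ k := by
    rw [← Real.sqrt_mul ha0, ← Real.sqrt_mul (by positivity)]
    apply Real.sqrt_le_iff.2 ⟨hNk.le, ?_⟩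
    calc (N : ℝ) * (a * b) ≤ N * (a * b) * N := le_mul_of_one_le_right (by positivity) hN
      _ = (N * a) * (N * b) := by ring
      _ ≤ N ^ k * N ^ k := by gcongr
      _ = _ := by ring
  refine hsum.trans ?_
  have hsN : 0 < √(N : ℝ) := Real.sqrt_pos.2 (by linarith)
  have e : a * b = (√a * √b) * (√a * √b) := by
    nth_rw 1 [← Real.mul_self_sqrt ha0, ← Real.mul_self_sqrt hb0]; ring
  rw [mul_assoc, mul_assoc, one_div_mul_eq_div, one_div_mul_eq_div, div_le_div_iff₀ hNk hsN, e]
  nlinarith [mul_nonneg (Real.sqrt_nonneg a) (Real.sqrt_nonneg b)]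

/-- The constant in the block estimate: a one-sided block has at most `k` elements, and there are
`2k` factors in all. -/
theorem sqrt_add_sqrt_card_le {s : ℕ} (hs : s ≤ k) :
    √s + √(2 * Fintype.card (Fin k ⊕ Fin k) : ℝ) ≤ 3 * √k := by
  have h1 : √(s : ℝ) ≤ √k := Real.sqrt_le_sqrt (Nat.cast_le.2 hs)
  have h2 : √(2 * Fintype.card (Fin k ⊕ Fin k) : ℝ) = 2 * √k := by
    rw [Fintype.card_sum, Fintype.card_fin, Real.sqrt_eq_iff_mul_self_eq (by positivity)
      (by positivity), mul_mul_mul_comm, Real.mul_self_sqrt (by positivity)]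
    push_cast
    ring
  linarith

theorem norm_overlap_le_of_inl {r : Setoid (Fin k ⊕ Fin k)} {x₀ : Fin k}
    (h : ∀ y, ¬ r (.inr y) (.inl x₀)) (r' : Setoid (Fin k ⊕ Fin k)) :
    ‖ind (kerClass N r') ⬝ᵥ (tensorSum k (fourier N)).mulVec (ind (kerClass N r))‖ ≤
      3 * √k / √N * √(kerClass N r').card * √(kerClass N r).card := by
  classical
  set S := Finset.univ.filter fun x => r x (.inl x₀) with hS
  have hS' : ∀ x, x ∈ S ↔ r x (.inl x₀) := fun x => by simp [hS]
  have hcard : S.card ≤ k := by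
    have : S ⊆ Finset.univ.map .inl := by
      rintro (x | y) hx
      · simp
      · exact absurd ((hS' _).1 hx) (h y)
    simpa using Finset.card_le_card this
  refine (norm_overlap_le_of_block (star_tensorSum_mul_self (fourierU N)) isPrimitiveRoot_rootN
    hS' ?_ _ add_const_mem_kerClass).trans ?_
  · rintro (x | y) hx m n t
    · exact fourier_add m n t
    · exact absurd ((hS' _).1 hx) (h y)
  · gcongr
    exact sqrt_add_sqrt_card_le hcard

theorem norm_overlap_le_of_inr {r : Setoid (Fin k ⊕ Fin k)} {y₀ : Fin k}
    (h : ∀ x, ¬ r (.inl x) (.inr y₀)) (r' : Setoid (Fin k ⊕ Fin k)) :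
    ‖ind (kerClass N r') ⬝ᵥ (tensorSum k (fourier N)).mulVec (ind (kerClass N r))‖ ≤
      3 * √k / √N * √(kerClass N r').card * √(kerClass N r).card := by
  classical
  set S := Finset.univ.filter fun x => r x (.inr y₀) with hS
  have hS' : ∀ x, x ∈ S ↔ r x (.inr y₀) := fun x => by simp [hS]
  have hcard : S.card ≤ k := by
    have : S ⊆ Finset.univ.map .inr := by
      rintro (x | y) hx
      · exact absurd ((hS' _).1 hx) (h x)
      · simp
    simpa using Finset.card_le_card this
  refine (norm_overlap_le_of_block (star_tensorSum_mul_self (fourierU N))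
    (isPrimitiveRoot_star isPrimitiveRoot_rootN) hS' ?_ _ add_const_mem_kerClass).trans ?_
  · rintro (x | y) hx m n t
    · exact absurd ((hS' _).1 hx) (h x)
    -- On conjugated factors the characters belong to the conjugate root, so a block must not mix
    -- the two halves.
    · change star (fourier N m (n + t)) = star (fourier N m n) * _
      rw [fourier_add, star_mul', star_pow, star_pow]
  · gcongr
    exact sqrt_add_sqrt_card_le hcard

/-- The normalized Fourier overlap of two partitions, neither of which is a pairing, is small. -/
theorem norm_overlap_le {r₁ r₂ : Setoid (Fin k ⊕ Fin k)} (h₁ : ∀ σ, r₁ ≠ pairing σ)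
    (h₂ : ∀ σ, r₂ ≠ pairing σ) :
    ‖ind (kerClass N r₁) ⬝ᵥ (tensorSum k (fourier N)).mulVec (ind (kerClass N r₂))‖ ≤
      3 * √k / √N * √(kerClass N r₁).card * √(kerClass N r₂).card := by
  rcases exists_block_or_small_or_pairing r₂ with ⟨x, hx⟩ | ⟨y, hy⟩ | ⟨T₂, hk₂, hT₂⟩ | ⟨σ, hσ⟩
  · exact norm_overlap_le_of_inl hx r₁
  · exact norm_overlap_le_of_inr hy r₁
  · rcases exists_block_or_small_or_pairing r₁ with ⟨x, hx⟩ | ⟨y, hy⟩ | ⟨T₁, hk₁, hT₁⟩ | ⟨σ, hσ⟩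
    -- A one-sided block in either partition suffices, since the Fourier matrix is symmetric.
    · rw [dotProduct_fourier_comm, mul_right_comm]
      exact norm_overlap_le_of_inl hx r₂
    · rw [dotProduct_fourier_comm, mul_right_comm]
      exact norm_overlap_le_of_inr hy r₂
    · refine (norm_overlap_le_of_small hk₁ hk₂ hT₁ hT₂).trans ?_
      have : 1 ≤ √(k : ℝ) := Real.one_le_sqrt.2 (by exact_mod_cast (by omega : 1 ≤ k))
      gcongr
      linarith
    · exact absurd hσ (h₁ σ)
  · exact absurd hσ (h₂ σ)

end Overlap

/-! ### The Fourier form on functions of the coincidence pattern. -/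

section ClassFunction

/-- A partition is recovered from its map to chosen representatives; this bounds the number of
partitions by that of self-maps. -/
theorem setoid_out_injective {ι : Type*} :
    Function.Injective fun (r : Setoid ι) (x : ι) => (Quotient.mk r x).out := by
  have key : ∀ (r : Setoid ι) (x y : ι),
      r x y ↔ (Quotient.mk r x).out = (Quotient.mk r y).out := fun r x y => by
    rw [Quotient.out_inj]
    exact Quotient.eq.symm
  intro r s h
  refine Setoid.ext fun x y => ?_
  rw [key r, key s]
  exact iff_of_eq (congrArg₂ (· = ·) (congrFun h x) (congrFun h y))

instance instFintypeSetoid {ι : Type*} [Fintype ι] [DecidableEq ι] : Fintype (Setoid ι) :=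
  Fintype.ofInjective _ setoid_out_injective

theorem card_setoid_le {ι : Type*} [Fintype ι] [DecidableEq ι] :
    Fintype.card (Setoid ι) ≤ Fintype.card ι ^ Fintype.card ι := by
  have h := Fintype.card_le_of_injective _ (setoid_out_injective (ι := ι))
  rwa [Fintype.card_fun] at h

variable {N k : ℕ}

/-- Overwriting the entry at `x` by an arbitrary value loses nothing, as the old entry survives at
`y`. -/
theorem mul_card_eq_le {x y : Fin k} (hxy : x ≠ y) :
    N * (Finset.univ.filter fun j : Fin k → Fin N => j x = j y).card ≤ N ^ k := by
  have h : ((Finset.univ : Finset (Fin N)) ×ˢ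
      (Finset.univ.filter fun j : Fin k → Fin N => j x = j y)).card ≤
      (Finset.univ : Finset (Fin k → Fin N)).card := by
    refine Finset.card_le_card_of_injOn (fun q => Function.update q.2 x q.1)
      (fun _ _ => Finset.mem_coe.2 (Finset.mem_univ _)) ?_
    rintro ⟨t, j⟩ hj ⟨t', j'⟩ hj' h
    simp only [Finset.coe_product, Set.mem_prod, Finset.mem_coe, Finset.mem_univ, true_and,
      Finset.mem_filter] at hj hj'
    have hne : ∀ z, z ≠ x → j z = j' z := fun z hz => by
      simpa [Function.update_of_ne hz] using congrFun h z
    have hx : t = t' := by simpa using congrFun h x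
    refine Prod.ext hx (funext fun z => ?_)
    by_cases hz : z = x
    · rw [hz]
      change j x = j' x
      rw [hj, hj', hne y hxy.symm]
    · exact hne z hz
  simpa [Finset.card_product] using h

-- A union bound over the pairs of places that may collide.
open Classical in
theorem mul_card_not_injective_le :
    N * (Finset.univ.filter fun j : Fin k → Fin N => ¬ Function.Injective j).card ≤
      k ^ 2 * N ^ k := by
  have hsub : (Finset.univ.filter fun j : Fin k → Fin N => ¬ Function.Injective j) ⊆
      (Finset.univ.filter fun q : Fin k × Fin k => q.1 ≠ q.2).biUnion fun q =>
        Finset.univ.filter fun j : Fin k → Fin N => j q.1 = j q.2 := by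
    intro j hj
    obtain ⟨x, y, h, hne⟩ : ∃ x y, j x = j y ∧ x ≠ y := by
      simpa [Function.Injective] using hj
    simp only [Finset.mem_biUnion, Finset.mem_filter, Finset.mem_univ, true_and]
    exact ⟨(x, y), hne, h⟩
  calc _ ≤ N * ∑ q ∈ Finset.univ.filter fun q : Fin k × Fin k => q.1 ≠ q.2,
        (Finset.univ.filter fun j : Fin k → Fin N => j q.1 = j q.2).card :=
        Nat.mul_le_mul_left _ ((Finset.card_le_card hsub).trans Finset.card_biUnion_le)
    _ ≤ ∑ q ∈ Finset.univ.filter fun q : Fin k × Fin k => q.1 ≠ q.2, N ^ k := by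
        rw [Finset.mul_sum]
        exact Finset.sum_le_sum fun q hq => mul_card_eq_le (Finset.mem_filter.1 hq).2
    _ ≤ ∑ q : Fin k × Fin k, N ^ k :=
        Finset.sum_le_sum_of_subset (Finset.filter_subset _ _)
    _ = _ := by simp [sq]

/-- A class function orthogonal to the vector of the permutation `σ` has little mass on the class
of `σ`. -/
theorem sum_pairing_norm_sq_le (hN : 2 * k ^ 2 ≤ N) (hN0 : 0 < N)
    {a : (Fin k ⊕ Fin k → Fin N) → ℂ}
    (hinv : ∀ i j, Setoid.ker i = Setoid.ker j → a i = a j) (σ : Equiv.Perm (Fin k))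
    (hperp : ∑ j : Fin k → Fin N, a (j ∘ Sum.elim id σ) = 0) :
    ∑ i ∈ kerClass N (pairing σ), ‖a i‖ ^ 2 ≤ 2 * (k : ℝ) ^ 2 / N * l2 a ^ 2 := by
  classical
  set g : Fin k ⊕ Fin k → Fin k := Sum.elim id σ with hg
  have hgs : Function.Surjective g := fun x => ⟨.inl x, rfl⟩
  have hcomp : Function.Injective fun j : Fin k → Fin N => j ∘ g := hgs.injective_comp_right
  set J := Finset.univ.filter fun j : Fin k → Fin N => Function.Injective j with hJ
  set J' := Finset.univ.filter fun j : Fin k → Fin N => ¬ Function.Injective j with hJ'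
  have hker : ∀ j ∈ J, Setoid.ker (j ∘ g) = pairing σ := by
    intro j hj
    refine Setoid.ext fun x y => ?_
    change j (g x) = j (g y) ↔ g x = g y
    exact (Finset.mem_filter.1 hj).2.eq_iff
  have himage : kerClass N (pairing σ) ⊆ J.image fun j => j ∘ g := by
    intro i hi
    rw [mem_kerClass] at hi
    have hrel : ∀ x y, i x = i y ↔ g x = g y := fun x y => by
      rw [← Setoid.ker_def, hi]; rfl
    refine Finset.mem_image.2 ⟨fun x => i (.inl x), Finset.mem_filter.2 ⟨Finset.mem_univ _, ?_⟩, ?_⟩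
    · intro x y hxy
      exact (hrel _ _).1 hxy
    · funext x
      exact (hrel _ _).2 rfl
  have hcard : J.card + J'.card = N ^ k := by
    rw [hJ, hJ', Finset.card_filter_add_card_filter_not]
    simp
  have hJ'le : N * J'.card ≤ k ^ 2 * N ^ k := mul_card_not_injective_le
  obtain ⟨α, hα⟩ : ∃ α, ∀ j ∈ J, a (j ∘ g) = α := by
    -- There is no injective tuple when `N < k`; any `α` then serves.
    rcases J.eq_empty_or_nonempty with h | ⟨j₀, h₀⟩
    · exact ⟨0, fun j hj => by simp [h] at hj⟩
    · exact ⟨a (j₀ ∘ g), fun j hj => hinv _ _ (by rw [hker j hj, hker j₀ h₀])⟩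
  have hM : ∑ i ∈ kerClass N (pairing σ), ‖a i‖ ^ 2 ≤ J.card * ‖α‖ ^ 2 := by
    refine (Finset.sum_le_sum_of_subset_of_nonneg himage fun _ _ _ => sq_nonneg _).trans ?_
    rw [Finset.sum_image fun _ _ _ _ h => hcomp h, Finset.sum_congr rfl fun j hj => by rw [hα j hj]]
    simp
  -- The orthogonality runs over all tuples `j`, while the class of `σ` corresponds to injective
  -- ones. Hence the constant `α` is controlled by the few non-injective `j`, and Cauchy–Schwarz
  -- gives mass at most `|J'| / |J|` times `‖a‖²`.
  have hsum : (J.card : ℂ) * α = - ∑ j ∈ J', a (j ∘ g) := by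
    rw [eq_neg_iff_add_eq_zero, ← hperp, ← Finset.sum_filter_add_sum_filter_not Finset.univ
      (fun j : Fin k → Fin N => Function.Injective j), ← hJ, ← hJ',
      Finset.sum_congr rfl fun j hj => hα j hj]
    simp
  have hle : (J.card : ℝ) * (J.card * ‖α‖ ^ 2) ≤ J'.card * l2 a ^ 2 := by
    calc (J.card : ℝ) * (J.card * ‖α‖ ^ 2) = ‖(J.card : ℂ) * α‖ ^ 2 := by
          rw [norm_mul, Complex.norm_natCast]; ring
      _ ≤ (∑ j ∈ J', ‖a (j ∘ g)‖) ^ 2 := by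
          rw [hsum, norm_neg]; gcongr; exact norm_sum_le _ _
      _ ≤ J'.card * ∑ j ∈ J', ‖a (j ∘ g)‖ ^ 2 := sq_sum_le_card_mul_sum_sq
      _ ≤ J'.card * l2 a ^ 2 := by
          gcongr
          rw [l2_sq, ← Finset.sum_image (f := fun i => ‖a i‖ ^ 2) fun _ _ _ _ h => hcomp h]
          exact Finset.sum_le_sum_of_subset_of_nonneg (Finset.subset_univ _)
            fun _ _ _ => sq_nonneg _
  refine hM.trans ?_
  have hNr : (0 : ℝ) < N := Nat.cast_pos.2 hN0
  have h1 : (J.card : ℝ) + J'.card = (N : ℝ) ^ k := by exact_mod_cast hcard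
  have h2 : (N : ℝ) * J'.card ≤ (k : ℝ) ^ 2 * (N : ℝ) ^ k := by exact_mod_cast hJ'le
  have h3 : 2 * (k : ℝ) ^ 2 ≤ N := by exact_mod_cast hN
  have hNk : (0 : ℝ) < (N : ℝ) ^ k := by positivity
  have h4 : 2 * (J'.card : ℝ) ≤ (N : ℝ) ^ k := by
    have : (N : ℝ) * (2 * J'.card) ≤ N * (N : ℝ) ^ k := by nlinarith
    exact le_of_mul_le_mul_left this hNr
  rw [div_mul_eq_mul_div, le_div_iff₀ hNr]
  generalize hMdef : (J.card : ℝ) * ‖α‖ ^ 2 = M at *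
  have hM0 : 0 ≤ M := by rw [← hMdef]; positivity
  have h5 : (N : ℝ) ^ k * M ≤ 2 * (J'.card * l2 a ^ 2) := by nlinarith
  have h6 : (N : ℝ) ^ k * (M * N) ≤ (N : ℝ) ^ k * (2 * (k : ℝ) ^ 2 * l2 a ^ 2) := by
    nlinarith [mul_le_mul_of_nonneg_right h2 (sq_nonneg (l2 a)),
      mul_le_mul_of_nonneg_right h5 hNr.le]
  exact le_of_mul_le_mul_left h6 hNk

open Classical in
/-- The restriction of a function on tuples to the tuples of pattern `r`. -/
def component (a : (Fin k ⊕ Fin k → Fin N) → ℂ) (r : Setoid (Fin k ⊕ Fin k)) :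
    (Fin k ⊕ Fin k → Fin N) → ℂ :=
  fun i => if Setoid.ker i = r then a i else 0

theorem l2_component_sq (a : (Fin k ⊕ Fin k → Fin N) → ℂ) (r : Setoid (Fin k ⊕ Fin k)) :
    l2 (component a r) ^ 2 = ∑ i ∈ kerClass N r, ‖a i‖ ^ 2 := by
  rw [l2_sq, kerClass, Finset.sum_filter]
  refine Finset.sum_congr rfl fun i _ => ?_
  simp only [component]
  split_ifs <;> simp

theorem sum_l2_component_sq (a : (Fin k ⊕ Fin k → Fin N) → ℂ) :
    ∑ r, l2 (component a r) ^ 2 = l2 a ^ 2 := by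
  classical
  simp_rw [l2_component_sq, kerClass]
  rw [l2_sq]
  exact Finset.sum_fiberwise _ _ _

theorem exists_component_eq {a : (Fin k ⊕ Fin k → Fin N) → ℂ}
    (hinv : ∀ i j, Setoid.ker i = Setoid.ker j → a i = a j) (r : Setoid (Fin k ⊕ Fin k)) :
    ∃ α : ℂ, component a r = α • ind (kerClass N r) := by
  classical
  by_cases h : ∃ i : Fin k ⊕ Fin k → Fin N, Setoid.ker i = r
  · obtain ⟨i₀, h₀⟩ := h
    refine ⟨a i₀, funext fun i => ?_⟩
    by_cases hi : Setoid.ker i = r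
    · simp [component, ind, mem_kerClass.2 hi, hi, hinv i i₀ (hi.trans h₀.symm)]
    · simp [component, ind, mt mem_kerClass.1 hi, hi]
  · refine ⟨0, funext fun i => ?_⟩
    have hi : Setoid.ker i ≠ r := fun hi => h ⟨i, hi⟩
    simp [component, hi]

theorem l2_smul {X : Type*} [Fintype X] (c : ℂ) (u : X → ℂ) : l2 (c • u) = ‖c‖ * l2 u := by
  simpa [l2] using norm_smul c (WithLp.toLp 2 u)

theorem norm_component_form_le [NeZero N] {a : (Fin k ⊕ Fin k → Fin N) → ℂ}
    (hinv : ∀ i j, Setoid.ker i = Setoid.ker j → a i = a j) {r₁ r₂ : Setoid (Fin k ⊕ Fin k)}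
    (h₁ : ∀ σ, r₁ ≠ pairing σ) (h₂ : ∀ σ, r₂ ≠ pairing σ) :
    ‖star (component a r₁) ⬝ᵥ (tensorSum k (fourier N)).mulVec (component a r₂)‖ ≤
      3 * √k / √N * l2 (component a r₁) * l2 (component a r₂) := by
  obtain ⟨α, hα⟩ := exists_component_eq hinv r₁
  obtain ⟨β, hβ⟩ := exists_component_eq hinv r₂
  have hind : ∀ A : Finset (Fin k ⊕ Fin k → Fin N), star (ind A) = ind A := fun A => by
    funext i
    simp [ind, apply_ite]
  rw [hα, hβ, star_smul, hind, Matrix.mulVec_smul, smul_dotProduct, dotProduct_smul, l2_smul,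
    l2_smul, l2_ind, l2_ind, norm_smul, norm_smul, norm_star]
  calc _ ≤ ‖α‖ * (‖β‖ * (3 * √k / √N * √(kerClass N r₁).card * √(kerClass N r₂).card)) := by
        gcongr
        exact norm_overlap_le h₁ h₂
    _ = _ := by ring

theorem sum_component_apply (a : (Fin k ⊕ Fin k → Fin N) → ℂ)
    (S : Finset (Setoid (Fin k ⊕ Fin k))) [DecidableEq (Setoid (Fin k ⊕ Fin k))]
    (i : Fin k ⊕ Fin k → Fin N) :
    (∑ r ∈ S, component a r) i = if Setoid.ker i ∈ S then a i else 0 := by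
  rw [Finset.sum_apply]
  simp only [component]
  convert Finset.sum_ite_eq S (Setoid.ker i) fun _ => a i

theorem l2_sum_component_le (a : (Fin k ⊕ Fin k → Fin N) → ℂ)
    (S : Finset (Setoid (Fin k ⊕ Fin k))) : l2 (∑ r ∈ S, component a r) ≤ l2 a := by
  classical
  rw [l2_eq, l2_eq]
  refine Real.sqrt_le_sqrt (Finset.sum_le_sum fun i _ => ?_)
  rw [sum_component_apply]
  split_ifs <;> simp

theorem card_finset_setoid_le (S : Finset (Setoid (Fin k ⊕ Fin k))) :
    (S.card : ℝ) ≤ (2 * k : ℝ) ^ (2 * k) := by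
  have h := (Finset.card_le_univ S).trans (card_setoid_le (ι := Fin k ⊕ Fin k))
  rw [Fintype.card_sum, Fintype.card_fin, ← two_mul] at h
  exact_mod_cast h

theorem l2_sum_pairing_component_le (hN : 2 * k ^ 2 ≤ N) (hN0 : 0 < N)
    {a : (Fin k ⊕ Fin k → Fin N) → ℂ}
    (hinv : ∀ i j, Setoid.ker i = Setoid.ker j → a i = a j)
    (hperp : ∀ σ : Equiv.Perm (Fin k), ∑ j : Fin k → Fin N, a (j ∘ Sum.elim id σ) = 0)
    (P : Finset (Setoid (Fin k ⊕ Fin k))) (hP : ∀ r ∈ P, ∃ σ, r = pairing σ) :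
    l2 (∑ r ∈ P, component a r) ≤ (2 * k : ℝ) ^ (2 * k) * (√2 * k / √N * l2 a) := by
  calc l2 (∑ r ∈ P, component a r) ≤ ∑ r ∈ P, l2 (component a r) := by
        have := norm_sum_le P fun r => WithLp.toLp 2 (component a r)
        rwa [← WithLp.toLp_sum] at this
    _ ≤ ∑ r ∈ P, (√2 * k / √N * l2 a) := by
        refine Finset.sum_le_sum fun r hr => ?_
        obtain ⟨σ, rfl⟩ := hP r hr
        refine le_of_sq_le_sq ?_ (by positivity)
        rw [l2_component_sq, mul_pow, div_pow, mul_pow, Real.sq_sqrt (Nat.cast_nonneg N),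
          Real.sq_sqrt zero_le_two]
        exact sum_pairing_norm_sq_le hN hN0 hinv σ (hperp σ)
    _ ≤ _ := by
        rw [Finset.sum_const, nsmul_eq_mul]
        exact mul_le_mul_of_nonneg_right (card_finset_setoid_le P) (by positivity)

/-- Pairwise overlaps sum to the square of the sum of component norms; Cauchy–Schwarz over the
partitions costs their number once. -/
theorem norm_fourier_form_sum_component_le [NeZero N] {a : (Fin k ⊕ Fin k → Fin N) → ℂ}
    (hinv : ∀ i j, Setoid.ker i = Setoid.ker j → a i = a j)
    (R : Finset (Setoid (Fin k ⊕ Fin k))) (hR : ∀ r ∈ R, ∀ σ, r ≠ pairing σ) :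
    ‖star (∑ r ∈ R, component a r) ⬝ᵥ
        (tensorSum k (fourier N)).mulVec (∑ r ∈ R, component a r)‖ ≤
      (2 * k : ℝ) ^ (2 * k) * (3 * √k / √N) * l2 a ^ 2 := by
  rw [star_sum, Matrix.mulVec_sum, sum_dotProduct]
  simp_rw [dotProduct_sum]
  have hsq : (∑ r ∈ R, l2 (component a r)) ^ 2 ≤ (2 * k : ℝ) ^ (2 * k) * l2 a ^ 2 := by
    refine sq_sum_le_card_mul_sum_sq.trans
      (mul_le_mul (card_finset_setoid_le R) ?_ (by positivity) (by positivity))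
    rw [← sum_l2_component_sq a]
    exact Finset.sum_le_sum_of_subset_of_nonneg (Finset.subset_univ _) fun _ _ _ => sq_nonneg _
  calc _ ≤ ∑ r₁ ∈ R, ∑ r₂ ∈ R, 3 * √k / √N * l2 (component a r₁) * l2 (component a r₂) := by
        refine (norm_sum_le _ _).trans (Finset.sum_le_sum fun r₁ h₁ => ?_)
        refine (norm_sum_le _ _).trans (Finset.sum_le_sum fun r₂ h₂ => ?_)
        exact norm_component_form_le hinv (hR r₁ h₁) (hR r₂ h₂)
    _ = 3 * √k / √N * (∑ r ∈ R, l2 (component a r)) ^ 2 := by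
        rw [sq, Finset.sum_mul_sum, Finset.mul_sum]
        simp_rw [Finset.mul_sum, mul_assoc]
    _ ≤ 3 * √k / √N * ((2 * k : ℝ) ^ (2 * k) * l2 a ^ 2) :=
        mul_le_mul_of_nonneg_left hsq (by positivity)
    _ = _ := by ring

/-- The Fourier transform almost maps the class functions orthogonal to all permutations to
their orthogonal complement. -/
theorem norm_fourier_form_le [NeZero N] (hN : 2 * k ^ 2 ≤ N)
    {a : (Fin k ⊕ Fin k → Fin N) → ℂ}
    (hinv : ∀ i j, Setoid.ker i = Setoid.ker j → a i = a j)
    (hperp : ∀ σ : Equiv.Perm (Fin k), ∑ j : Fin k → Fin N, a (j ∘ Sum.elim id σ) = 0) :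
    ‖star a ⬝ᵥ (tensorSum k (fourier N)).mulVec a‖ ≤
      (2 * k : ℝ) ^ (2 * k) * (3 * √k + 2 * (√2 * k)) / √N * l2 a ^ 2 := by
  classical
  have hYu : ∀ u, l2 ((tensorSum k (fourier N)).mulVec u) = l2 u :=
    l2_mulVec_of_unitary (star_tensorSum_mul_self (fourierU N))
  have hP := l2_sum_pairing_component_le hN (NeZero.pos N) hinv hperp
    (Finset.univ.filter fun r : Setoid (Fin k ⊕ Fin k) => ∃ σ, r = pairing σ)
    fun r hr => (Finset.mem_filter.1 hr).2
  have hR := norm_fourier_form_sum_component_le hinv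
    (Finset.univ.filter fun r : Setoid (Fin k ⊕ Fin k) => ¬ ∃ σ, r = pairing σ)
    fun r hr => not_exists.1 (Finset.mem_filter.1 hr).2
  have hlR := l2_sum_component_le a
    (Finset.univ.filter fun r : Setoid (Fin k ⊕ Fin k) => ¬ ∃ σ, r = pairing σ)
  have hsum : (∑ r : Setoid (Fin k ⊕ Fin k) with ¬ ∃ σ, r = pairing σ, component a r) +
      (∑ r : Setoid (Fin k ⊕ Fin k) with ∃ σ, r = pairing σ, component a r) = a := by
    funext i
    rw [Pi.add_apply, sum_component_apply, sum_component_apply]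
    by_cases h : ∃ σ, Setoid.ker i = pairing σ <;> simp [h]
  generalize (∑ r : Setoid (Fin k ⊕ Fin k) with ¬ ∃ σ, r = pairing σ, component a r) = aR at *
  generalize (∑ r : Setoid (Fin k ⊕ Fin k) with ∃ σ, r = pairing σ, component a r) = aP at *
  generalize tensorSum k (fourier N) = Y at *
  -- Grouped so that pairing components enter in only two terms, each bounded by `‖aP‖ ‖a‖` through
  -- unitarity.
  have hexp : star a ⬝ᵥ Y.mulVec a =
      star aR ⬝ᵥ Y.mulVec aR + (star aP ⬝ᵥ Y.mulVec a + star aR ⬝ᵥ Y.mulVec aP) := by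
    rw [← hsum, star_add, add_dotProduct, Matrix.mulVec_add, dotProduct_add]
    ring
  have hc1 : ‖star aP ⬝ᵥ Y.mulVec a‖ ≤ l2 aP * l2 a := by
    refine (norm_dotProduct_le _ _).trans ?_
    rw [l2_star, hYu]
  have hc2 : ‖star aR ⬝ᵥ Y.mulVec aP‖ ≤ l2 aP * l2 a := by
    refine (norm_dotProduct_le _ _).trans ?_
    rw [l2_star, hYu, mul_comm]
    exact mul_le_mul_of_nonneg_left hlR (norm_nonneg _)
  have hPa := mul_le_mul_of_nonneg_right hP (norm_nonneg (WithLp.toLp 2 a))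
  rw [hexp]
  refine (norm_add_le _ _).trans
    ((add_le_add hR ((norm_add_le _ _).trans (add_le_add (hc1.trans hPa) (hc2.trans hPa)))).trans
      (le_of_eq ?_))
  ring

theorem three_sqrt_add_le (k : ℕ) : 3 * √k + 2 * (√2 * k) ≤ 2 * (2 * k : ℝ) ^ (2 * k) := by
  rcases Nat.eq_zero_or_pos k with rfl | hk
  · simp
  · have hk1 : (1 : ℝ) ≤ k := by exact_mod_cast hk
    have h1 : √(k : ℝ) ≤ k := Real.sqrt_le_iff.2 ⟨by linarith, by nlinarith⟩
    have h2 : √2 ≤ 3 / 2 := Real.sqrt_le_iff.2 ⟨by norm_num, by norm_num⟩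
    have h3 : (2 * k : ℝ) ^ 2 ≤ (2 * k : ℝ) ^ (2 * k) :=
      pow_le_pow_right₀ (by linarith) (by omega)
    nlinarith

end ClassFunction

/-! ### Vectors fixed by permutations and killed by the Haar average. -/

section Gap

variable {N k : ℕ}

/-- Tuples with the same pattern differ by a permutation of the values. -/
theorem exists_perm_comp_eq {ι : Type*} {i j : ι → Fin N} (h : Setoid.ker i = Setoid.ker j) :
    ∃ π : Equiv.Perm (Fin N), π ∘ i = j := by
  classical
  let e : {a // a ∈ Set.range i} ≃ {a // a ∈ Set.range j} :=
    (Setoid.quotientKerEquivRange i).symm.trans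
      ((Quotient.congrRight fun a b => by rw [h]).trans (Setoid.quotientKerEquivRange j))
  refine ⟨e.extendSubtype, funext fun x => ?_⟩
  rw [Function.comp_apply, Equiv.extendSubtype_apply_of_mem e _ ⟨x, rfl⟩]
  have : (Setoid.quotientKerEquivRange i).symm ⟨i x, x, rfl⟩ = Quotient.mk _ x := by
    rw [Equiv.symm_apply_eq]; rfl
  simp only [e, Equiv.trans_apply, this]
  rfl

theorem tensorSum_B_apply (π : Equiv.Perm (Fin N)) (i j : Fin k ⊕ Fin k → Fin N) :
    tensorSum k (B π) i j = if i = π ∘ j then 1 else 0 := by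
  rw [tensorSum, B_map_star, tensor_apply]
  have : ∀ x : Fin k ⊕ Fin k, (Sum.elim (fun _ => B π) (fun _ => B π) x : Matrix _ _ ℂ)
      (i x) (j x) = if i x = π (j x) then 1 else 0 := by
    rintro (x | x) <;> rfl
  simp_rw [this]
  rw [Finset.prod_ite_zero]
  simp [funext_iff]

theorem classFunction_of_fixed {v : (Fin k ⊕ Fin k → Fin N) → ℂ}
    (hv : (unifMoment N k).mulVec v = v) {i j : Fin k ⊕ Fin k → Fin N}
    (h : Setoid.ker i = Setoid.ker j) : v i = v j := by
  obtain ⟨π, rfl⟩ := exists_perm_comp_eq h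
  have h1 : (tensorSum k (B π)).mulVec v = v := by
    rw [← hv, Matrix.mulVec_mulVec, tensorSum_B_mul_unifMoment]
  have h2 := congrFun h1 (π ∘ i)
  rw [← h2, Matrix.mulVec, dotProduct]
  simp_rw [tensorSum_B_apply, π.injective.comp_left.eq_iff]
  simp

/-- The vector of a permutation is invariant under all unitaries. -/
theorem sum_tensorSum_comp (V : U N) (σ : Equiv.Perm (Fin k)) (i : Fin k ⊕ Fin k → Fin N) :
    ∑ j : Fin k → Fin N, tensorSum k (V : Matrix (Fin N) (Fin N) ℂ) (j ∘ Sum.elim id σ) i =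
      ∏ x, (1 : Matrix (Fin N) (Fin N) ℂ) (i (.inr (σ.symm x))) (i (.inl x)) := by
  have hV := Matrix.mem_unitaryGroup_iff'.1 V.2
  -- Each delta is an entry of `V* V`; expanding the product frees one summation index per factor,
  -- and these form the tuple `j`.
  rw [← hV]
  simp_rw [Matrix.mul_apply, Matrix.star_apply]
  rw [Fintype.prod_sum]
  refine Finset.sum_congr rfl fun j _ => ?_
  rw [tensorSum_apply_elim, Finset.prod_mul_distrib, mul_comm]
  congr 1
  rw [← Equiv.prod_comp σ fun x =>
    star ((V : Matrix (Fin N) (Fin N) ℂ) (j x) (i (.inr (σ.symm x))))]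
  simp

theorem sum_haarMoment_comp (σ : Equiv.Perm (Fin k)) (i : Fin k ⊕ Fin k → Fin N) :
    ∑ j : Fin k → Fin N, haarMoment N k (j ∘ Sum.elim id σ) i =
      ∏ x, (1 : Matrix (Fin N) (Fin N) ℂ) (i (.inr (σ.symm x))) (i (.inl x)) := by
  simp only [haarMoment, Matrix.of_apply]
  rw [← integral_finsetSum _ fun j _ => integrable_tensorSum_apply k _ i _]
  simp_rw [sum_tensorSum_comp]
  simp

/-- Pairing with the vector of `σ` gives the same value on `G v` as on `v`, here seen by comparing
`G` with the unitary `1`. Only the invariance of these vectors is needed, not that they span the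
range of `G`. -/
theorem sum_comp_eq_zero_of_haarMoment {v : (Fin k ⊕ Fin k → Fin N) → ℂ}
    (hv : (haarMoment N k).mulVec v = 0) (σ : Equiv.Perm (Fin k)) :
    ∑ j : Fin k → Fin N, v (j ∘ Sum.elim id σ) = 0 := by
  have key : ∀ A : Matrix (Fin k ⊕ Fin k → Fin N) (Fin k ⊕ Fin k → Fin N) ℂ,
      ∑ j : Fin k → Fin N, A.mulVec v (j ∘ Sum.elim id σ) =
        ∑ i, (∑ j : Fin k → Fin N, A (j ∘ Sum.elim id σ) i) * v i := by
    intro A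
    simp only [Matrix.mulVec, dotProduct, Finset.sum_mul]
    exact Finset.sum_comm
  have h1 := key (haarMoment N k)
  have h2 := key (tensorSum k ((1 : U N) : Matrix (Fin N) (Fin N) ℂ))
  simp_rw [sum_haarMoment_comp] at h1
  simp_rw [sum_tensorSum_comp] at h2
  rw [← h1, hv, OneMemClass.coe_one, tensorSum_one, Matrix.one_mulVec] at h2
  rw [h2]
  simp

theorem two_mul_sq_le_of_epsA_pos [NeZero N] (hA : 0 < epsA N k) : 2 * k ^ 2 ≤ N := by
  rcases Nat.eq_zero_or_pos k with rfl | hk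
  · simp
  · have hN : (0 : ℝ) < √N := Real.sqrt_pos.2 (Nat.cast_pos.2 (NeZero.pos N))
    have hk1 : (1 : ℝ) ≤ k := by exact_mod_cast hk
    have h1 : 2 * (2 * (k : ℝ)) ^ (4 * k) < √N := by
      rw [epsA, sub_pos, div_lt_one hN] at hA
      exact hA
    have h2 : (2 * k : ℝ) ^ 1 ≤ (2 * k : ℝ) ^ (4 * k) :=
      pow_le_pow_right₀ (by linarith) (by omega)
    have h3 : 4 * (k : ℝ) ≤ √N := by nlinarith
    have h4 := Real.sq_sqrt (Nat.cast_nonneg (α := ℝ) N)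
    have : (2 * (k : ℝ) ^ 2) ≤ N := by nlinarith
    exact_mod_cast this

theorem re_inner_fourier_le [NeZero N] (hA : 0 < epsA N k)
    (v : EuclideanSpace ℂ (Fin k ⊕ Fin k → Fin N))
    (hG : Matrix.toEuclideanCLM (𝕜 := ℂ) (haarMoment N k) v = 0)
    (hP : Matrix.toEuclideanCLM (𝕜 := ℂ) (unifMoment N k) v = v) :
    (inner ℂ v (Matrix.toEuclideanCLM (𝕜 := ℂ) (tensorSum k (fourier N)) v)).re ≤
      (1 - epsA N k) * ‖v‖ ^ 2 := by
  have hG' : (haarMoment N k).mulVec v.ofLp = 0 := by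
    rw [← Matrix.ofLp_toEuclideanCLM, hG]; rfl
  have hP' : (unifMoment N k).mulVec v.ofLp = v.ofLp := by
    rw [← Matrix.ofLp_toEuclideanCLM, hP]
  have h := norm_fourier_form_le (two_mul_sq_le_of_epsA_pos hA)
    (fun i j => classFunction_of_fixed hP') (sum_comp_eq_zero_of_haarMoment hG')
  rw [EuclideanSpace.inner_eq_star_dotProduct, Matrix.ofLp_toEuclideanCLM, dotProduct_comm]
  refine (Complex.re_le_norm _).trans (h.trans ?_)
  change _ * ‖v‖ ^ 2 ≤ _
  refine mul_le_mul_of_nonneg_right ?_ (sq_nonneg _)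
  rw [epsA, sub_sub_cancel]
  refine div_le_div_of_nonneg_right ?_ (Real.sqrt_nonneg _)
  calc _ ≤ (2 * k : ℝ) ^ (2 * k) * (2 * (2 * k : ℝ) ^ (2 * k)) := by
        gcongr; exact three_sqrt_add_le k
    _ = _ := by rw [show 4 * k = 2 * k + 2 * k by ring, pow_add]; ring

end Gap

/-! ### The mixed distribution, its moments and its support. -/

section Mixture

variable {N : ℕ}

theorem mix_toMeasure {α : Type*} [MeasurableSpace α] (p : ℝ) (hp : p ∈ Set.Icc (0 : ℝ) 1)
    (μ ν : PMF α) : (mix p hp μ ν).toMeasure =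
      ENNReal.ofReal p • μ.toMeasure + ENNReal.ofReal (1 - p) • ν.toMeasure := by
  ext s hs
  simp only [Measure.coe_add, Measure.coe_smul, Pi.add_apply, Pi.smul_apply, smul_eq_mul,
    PMF.toMeasure_apply _ hs]
  rw [← ENNReal.tsum_mul_left, ← ENNReal.tsum_mul_left, ← ENNReal.tsum_add]
  refine tsum_congr fun x => ?_
  by_cases hx : x ∈ s
  · simp only [Set.indicator_of_mem hx]; rfl
  · simp [hx]

theorem integral_nuQ (p : ℝ) (hp : p ∈ Set.Icc (0 : ℝ) 1) (νC : PMF (Equiv.Perm (Fin N)))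
    {f : U N → ℂ} (hf : Continuous f) :
    ∫ V, f V ∂(nuQ p hp νC).toMeasure =
      (p : ℂ) * ∑ π, (νC π).toReal • f (permU π) + ((1 - p : ℝ) : ℂ) * f (fourierU N) := by
  let _ : MeasurableSpace (Equiv.Perm (Fin N)) := ⊤
  have hfint : ∀ (μ : Measure (U N)) [IsFiniteMeasure μ], Integrable f μ := fun μ _ =>
    hf.integrable_of_hasCompactSupport (HasCompactSupport.of_compactSpace _)
  have hmap : ∫ V, f V ∂(νC.map permU).toMeasure = ∑ π, (νC π).toReal • f (permU π) := by
    rw [← PMF.toMeasure_map permU νC measurable_from_top,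
      integral_map measurable_from_top.aemeasurable hf.aestronglyMeasurable, PMF.integral_eq_sum]
  rw [nuQ, mix_toMeasure, integral_add_measure ((hfint _).smul_measure ENNReal.ofReal_ne_top)
    ((hfint _).smul_measure ENNReal.ofReal_ne_top), integral_smul_measure, integral_smul_measure,
    hmap, PMF.toMeasure_pure, integral_dirac, ENNReal.toReal_ofReal hp.1,
    ENNReal.toReal_ofReal (sub_nonneg.2 hp.2), Complex.real_smul, Complex.real_smul]

theorem quantumMoment_nuQ (k : ℕ) (p : ℝ) (hp : p ∈ Set.Icc (0 : ℝ) 1)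
    (νC : PMF (Equiv.Perm (Fin N))) :
    quantumMoment k (nuQ p hp νC).toMeasure =
      ((p : ℂ) • permMoment k νC + ((1 - p : ℝ) : ℂ) • tensorSum k (fourier N)).submatrix
        (Equiv.sumArrowEquivProdArrow _ _ _).symm (Equiv.sumArrowEquivProdArrow _ _ _).symm := by
  ext i j
  simp only [quantumMoment, tensorPow₂_eq_submatrix, Matrix.of_apply, Matrix.submatrix_apply]
  rw [integral_nuQ p hp νC (continuous_tensorSum_apply k _ _)]
  simp only [permMoment, Matrix.add_apply, Matrix.smul_apply, Matrix.sum_apply, smul_eq_mul]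
  rfl

theorem permU_injective : Function.Injective (permU : Equiv.Perm (Fin N) → U N) := by
  intro π τ h
  ext b
  have h1 := congrFun (congrFun (congrArg Subtype.val h) (π b)) b
  by_contra hne
  have hne' : π b ≠ τ b := fun h => hne (congrArg _ h)
  simp [permU, B, hne'] at h1

/-- A permutation matrix has an entry of modulus `1`, whereas all Fourier entries have modulus
`1/√N`. -/
theorem permU_ne_fourierU (hN : 1 < N) (π : Equiv.Perm (Fin N)) : permU π ≠ fourierU N := by
  intro h
  have : NeZero N := ⟨by omega⟩
  have h1 := congrArg norm (congrFun (congrFun (congrArg Subtype.val h) (π 0)) 0)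
  have h2 : ‖(fourierU N : Matrix (Fin N) (Fin N) ℂ) (π 0) 0‖ = 1 / √N := norm_fourier_apply _ _
  rw [h2] at h1
  have h3 : N = 1 := by simpa [permU, B] using h1
  omega

theorem support_nuQ {p : ℝ} (hp : p ∈ Set.Ioo (0 : ℝ) 1) (νC : PMF (Equiv.Perm (Fin N))) :
    (nuQ p (Set.Ioo_subset_Icc_self hp) νC).support =
      insert (fourierU N) (permU '' νC.support) := by
  ext V
  rw [← PMF.support_map]
  have h : nuQ p (Set.Ioo_subset_Icc_self hp) νC V =
      ENNReal.ofReal p * (νC.map permU) V + ENNReal.ofReal (1 - p) * PMF.pure (fourierU N) V := rfl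
  rw [PMF.mem_support_iff, h, Set.mem_insert_iff, PMF.mem_support_iff, Ne, add_eq_zero, mul_eq_zero,
    mul_eq_zero, ENNReal.ofReal_eq_zero, ENNReal.ofReal_eq_zero, PMF.pure_apply]
  have h0 : ¬ p ≤ 0 := not_le.2 hp.1
  have h1 : ¬ 1 - p ≤ 0 := not_le.2 (sub_pos.2 hp.2)
  by_cases hV : V = fourierU N <;> simp [h0, h1, hV]

/-- For `N = 1` the subtracted term is at least `2`; for `k = 0` this rests on `0 ^ 0 = 1`. -/
theorem one_lt_of_epsA_pos {k : ℕ} (hN : 0 < N) (hA : 0 < epsA N k) : 1 < N := by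
  by_contra h
  obtain rfl : N = 1 := by omega
  rw [epsA, Nat.cast_one, Real.sqrt_one, div_one] at hA
  rcases Nat.eq_zero_or_pos k with rfl | hk
  · norm_num at hA
  · have : (1 : ℝ) ≤ (2 * (k : ℝ)) ^ (4 * k) := one_le_pow₀ (by
      have : (1 : ℝ) ≤ k := by exact_mod_cast hk
      linarith)
    linarith

theorem epsA_le_one (N k : ℕ) : epsA N k ≤ 1 := by
  rw [epsA]
  have : 0 ≤ 2 * (2 * (k : ℝ)) ^ (4 * k) / √N := by positivity
  linarith

theorem schattenInf_nuQ_le {k : ℕ} (hN : 0 < N) {εC : ℝ} (hC0 : 0 < εC) (hC1 : εC ≤ 1)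
    {νC : PMF (Equiv.Perm (Fin N))}
    (hC : schattenInf (classicalMoment (2 * k) νC -
      classicalMoment (2 * k) (PMF.uniformOfFintype (Equiv.Perm (Fin N)))) ≤ 1 - εC)
    (hA : 0 < epsA N k) {p : ℝ} (hp : p ∈ Set.Ioo (0 : ℝ) 1) :
    schattenInf (quantumMoment k (nuQ p (Set.Ioo_subset_Icc_self hp) νC).toMeasure -
      quantumMoment k (haar N)) ≤ 1 - gapBound N k εC p := by
  have : NeZero N := ⟨hN.ne'⟩
  rw [classicalMoment_eq_submatrix, classicalMoment_eq_submatrix] at hC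
  replace hC := (schattenInf_submatrix (tupleEquiv N k)
    (permMoment k νC - unifMoment N k)).symm.trans_le hC
  rw [quantumMoment_nuQ, quantumMoment_haar]
  refine (schattenInf_submatrix (Equiv.sumArrowEquivProdArrow (Fin k) (Fin k) (Fin N)).symm
    ((p : ℂ) • permMoment k νC + ((1 - p : ℝ) : ℂ) • tensorSum k (fourier N) -
      haarMoment N k)).trans_le ?_
  rw [schattenInf, map_sub] at hC
  rw [schattenInf, map_sub, map_add, map_smul, map_smul]
  have hmul : ∀ {A B C : Matrix (Fin k ⊕ Fin k → Fin N) (Fin k ⊕ Fin k → Fin N) ℂ}, A * B = C →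
      Matrix.toEuclideanCLM (𝕜 := ℂ) A * Matrix.toEuclideanCLM (𝕜 := ℂ) B =
        Matrix.toEuclideanCLM (𝕜 := ℂ) C := by
    rintro A B C rfl
    rw [map_mul]
  have hBG : ∀ π, tensorSum k (B π) * haarMoment N k = haarMoment N k := fun π =>
    tensorSum_mul_haarMoment k (permU π)
  have hGB : ∀ π, haarMoment N k * tensorSum k (B π) = haarMoment N k := fun π =>
    haarMoment_mul_tensorSum k (permU π)
  refine norm_mixture_sub_le hp hC0 hC1 hA (epsA_le_one N k)
    ((isSelfAdjoint_haarMoment k).map _) (hmul (haarMoment_mul_self k))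
    ((isSelfAdjoint_unifMoment k).map _)
    (hmul (permMoment_mul_of_fixed k _ _ (tensorSum_B_mul_unifMoment k)))
    (hmul (permMoment_mul_of_fixed k _ _ (tensorSum_B_mul_unifMoment k)))
    (hmul (mul_permMoment_of_fixed k _ _ (unifMoment_mul_tensorSum_B k))) hC (fun v => ?_)
    (hmul (permMoment_mul_of_fixed k _ _ hBG))
    (hmul (tensorSum_mul_haarMoment k (fourierU N)))
    (hmul (mul_permMoment_of_fixed k _ _ hGB)) fun v hG hP => re_inner_fourier_le hA v hG hP
  exact l2_mulVec_of_unitary (star_tensorSum_mul_self (fourierU N)) v.ofLp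

end Mixture

/-! ### Expander property and optimal mixing weight. -/

section Main

variable {N D k : ℕ} {εC : ℝ} {νC : PMF (Equiv.Perm (Fin N))}

theorem gapBound_pos (hC0 : 0 < εC) (hA : 0 < epsA N k) {p : ℝ} (hp : p ∈ Set.Ioo (0 : ℝ) 1) :
    0 < gapBound N k εC p :=
  mul_pos (by linarith) (lt_min (mul_pos hp.1 hC0) (sub_pos.2 hp.2))

theorem isQuantumTPE_nuQ (hN : 0 < N) (hC0 : 0 < εC) (hC1 : εC ≤ 1)
    (hC : IsClassicalTPE N D (1 - εC) (2 * k) νC) (hA : 0 < epsA N k) {p : ℝ}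
    (hp : p ∈ Set.Ioo (0 : ℝ) 1) :
    IsQuantumTPE N (D + 1) (1 - gapBound N k εC p) k (nuQ p (Set.Ioo_subset_Icc_self hp) νC) where
  support_le := by
    rw [support_nuQ hp]
    refine (Set.encard_insert_le _ _).trans ?_
    rw [permU_injective.encard_image]
    push_cast
    gcongr
    exact hC.support_le
  norm_le := schattenInf_nuQ_le hN hC0 hC1 hC.norm_le hA hp
  lam_lt_one := by linarith [gapBound_pos hC0 hA hp]

theorem encard_support_nuQ (hN : 1 < N) {p : ℝ} (hp : p ∈ Set.Ioo (0 : ℝ) 1) :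
    (nuQ p (Set.Ioo_subset_Icc_self hp) νC).support.encard = νC.support.encard + 1 := by
  rw [support_nuQ hp, Set.encard_insert_of_notMem, permU_injective.encard_image]
  rintro ⟨π, -, h⟩
  exact permU_ne_fourierU hN π h

/-- At this weight the two arguments of the minimum agree. -/
theorem gapBound_optimal (hC0 : 0 < εC) :
    gapBound N k εC (1 / (1 + εC)) = epsA N k / 12 * (εC / (1 + εC)) := by
  have h : 1 - 1 / (1 + εC) = 1 / (1 + εC) * εC := by field_simp; ring
  rw [gapBound, h, min_self]
  ring

theorem isMaxOn_gapBound (hC0 : 0 < εC) (hA : 0 < epsA N k) :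
    IsMaxOn (gapBound N k εC) (Set.Ioo (0 : ℝ) 1) (1 / (1 + εC)) := by
  intro p hp
  rw [Set.mem_ofPred_eq, gapBound_optimal hC0, gapBound]
  gcongr
  rw [le_div_iff₀ (by linarith)]
  have h1 := min_le_left (p * εC) (1 - p)
  have h2 := min_le_right (p * εC) (1 - p)
  -- Adding `εC` times `h2` to `h1` eliminates `p`.
  nlinarith

end Main

end TPE

end

theorem theorem1p6 (N D k : ℕ) (hN : 0 < N) (εC : ℝ) (νC : PMF (Equiv.Perm (Fin N)))
    (hC : TPE.IsClassicalTPE N D (1 - εC) (2 * k) νC) (hA : 0 < TPE.epsA N k) :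
    (∀ (p : ℝ) (hp : p ∈ Set.Ioo (0 : ℝ) 1),
      0 < TPE.gapBound N k εC p ∧
      (∃ εQ : ℝ, TPE.gapBound N k εC p ≤ εQ ∧
        TPE.IsQuantumTPE N (D + 1) (1 - εQ) k (TPE.nuQ p (Set.Ioo_subset_Icc_self hp) νC)) ∧
      (νC.support.encard = D →
        (TPE.nuQ p (Set.Ioo_subset_Icc_self hp) νC).support.encard = D + 1)) ∧
    IsMaxOn (TPE.gapBound N k εC) (Set.Ioo (0 : ℝ) 1) (1 / (1 + εC)) ∧
    ∃ hp : 1 / (1 + εC) ∈ Set.Ioo (0 : ℝ) 1,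
      ∃ εQ : ℝ, TPE.epsA N k * εC / 24 ≤ εQ ∧
        TPE.IsQuantumTPE N (D + 1) (1 - εQ) k
          (TPE.nuQ (1 / (1 + εC)) (Set.Ioo_subset_Icc_self hp) νC) := by
  have hC0 : 0 < εC := by linarith [hC.lam_lt_one]
  -- An operator norm is nonnegative, so `1 - εC` is.
  have hC1 : εC ≤ 1 := by
    have h := hC.norm_le
    have h0 : 0 ≤ TPE.schattenInf (TPE.classicalMoment (2 * k) νC -
      TPE.classicalMoment (2 * k) (PMF.uniformOfFintype (Equiv.Perm (Fin N)))) := norm_nonneg _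
    linarith
  have hp0 : 1 / (1 + εC) ∈ Set.Ioo (0 : ℝ) 1 :=
    ⟨by positivity, (div_lt_one (by linarith)).2 (by linarith)⟩
  refine ⟨fun p hp => ⟨TPE.gapBound_pos hC0 hA hp,
    ⟨_, le_rfl, TPE.isQuantumTPE_nuQ hN hC0 hC1 hC hA hp⟩, fun hD => ?_⟩,
    TPE.isMaxOn_gapBound hC0 hA, hp0, _, ?_, TPE.isQuantumTPE_nuQ hN hC0 hC1 hC hA hp0⟩
  · rw [TPE.encard_support_nuQ (TPE.one_lt_of_epsA_pos hN hA) hp, hD]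
  · rw [TPE.gapBound_optimal hC0]
    -- `1 + εC ≤ 2` turns the factor `12` into `24`.
    have h : εC / 2 ≤ εC / (1 + εC) := by gcongr; linarith
    nlinarith
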